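/- Let $\mathcal K$ be a complex Hilbert space with an antilinear involution $\Gamma=\Gamma^*=\Gamma^{-1}$, and let $\mathcal L_\varphi,\mathcal L_\pi\subset\mathcal K$ be closed complex subspaces that are invariant under $\Gamma$, with orthogonal projections $E_\varphi,E_\pi$. Put $\mathcal L=(1+\Gamma)\mathcal L_\varphi+(1-\Gamma)\mathcal L_\pi$, a real linear subspace of $\mathcal K$. Let $\mathcal H$ be the antisymmetric Fock space over $\mathcal K$ with vacuum vector $\Omega$ and creation and annihilation operators $a^*(\psi)$, $a(\psi)=a^*(\psi)^*$ satisfying the canonical anticommutation relations; let $\phi(\psi)=a^*(\psi)+a(\psi)$, and let $\mathcal A(\mathcal L)=\{\phi(\psi):\psi\in\mathcal L\}''$ be the von Neumann algebra generated by the fields $\phi(\psi)$, $\psi\in\mathcal L$. Let $X$ be a densely defined, possibly unbounded, strictly positive operator on $\mathcal K$ (that is, $\langle\psi,X\psi\rangle>0$ for all nonzero $\psi\in\operatorname{dom}X$) which commutes with $\Gamma$. Denote its second quantization, the closed operator $\bigoplus_{n\ge0}X^{\otimes n}$ on $\mathcal H$, by $X$ as well, and assume that $\mathcal A(\mathcal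 L)\Omega$ is contained in the domain of this operator. A linear map $\Xi:\mathcal A\to\mathcal H$ between Banach spaces is called nuclear if there are $\rho_k\in\mathcal A^*$ and $\Psi_k\in\mathcal H$, $k\in\mathbb N$, with $\Xi(A)=\sum_k\rho_k(A)\Psi_k$ for all $A\in\mathcal A$ and $\sum_k\|\rho_k\|\|\Psi_k\|<\infty$; its nuclear norm $\|\Xi\|_1$ is the infimum of $\sum_k\|\rho_k\|\|\Psi_k\|$ over all such representations. For a trace class operator $T$ on $\mathcal K$ let $\|T\|_1=\operatorname{Tr}|T|$, and for a positive trace class operator $S$ with eigenvalues $s_j$, repeated according to multiplicity, let $\det(1+S)=\prod_j(1+s_j)$. Assume that $E_\varphi X$ and $E_\pi X$ extend to trace class operators $T_\varphi$ and $T_\pi$ on $\mathcal K$. Then the map $$\Xi_{\mathcal L}:\mathcal A(\mathcal L)\to\mathcal H,\qquad \Xi_{\mathcal L}(A)=XA\Omega,$$ is nuclear, the positive operator $T=(|T_\varphi|^2+|T_\pi|^2)^{1/2}$ is trace class, and $$\|\Xi_{\mathcal L}\|_1\;\le\;\det(1+2T)\;\le\;e^{2\|T_\varphi\|_1}\,e^{2\|T_\pi\|_1}.$$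 -/

import Mathlib

open scoped InnerProductSpace ComplexConjugate ComplexOrder

noncomputable section

namespace FermiFock

universe u

section Algebraic

variable {K : Type u} [NormedAddCommGroup K] [InnerProductSpace ℂ K]

/-- Annihilation by `v` on the exterior algebra over `K`: the contraction with `⟪v, ·⟫`, i.e. the
antiderivation with `annihAlg v (ι w * x) = ⟪v, w⟫ • x - ι w * annihAlg v x` and
`annihAlg v 1 = 0`. -/
def annihAlg (v : K) : ExteriorAlgebra ℂ K →ₗ[ℂ] ExteriorAlgebra ℂ K :=
  CliffordAlgebra.contractLeft (Q := (0 : QuadraticForm ℂ K)) (innerₛₗ ℂ v)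

/-- Creation by `v` on the exterior algebra: left multiplication `x ↦ v ∧ x`. -/
def createAlg (v : K) : ExteriorAlgebra ℂ K →ₗ[ℂ] ExteriorAlgebra ℂ K :=
  LinearMap.mulLeft ℂ (ExteriorAlgebra.ι ℂ v)

theorem annihAlg_ι_mul (v w : K) (x : ExteriorAlgebra ℂ K) :
    annihAlg v (ExteriorAlgebra.ι ℂ w * x)
      = ⟪v, w⟫_ℂ • x - ExteriorAlgebra.ι ℂ w * annihAlg v x :=
  CliffordAlgebra.contractLeft_ι_mul (Q := (0 : QuadraticForm ℂ K)) _ w x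

theorem annihAlg_algebraMap (v : K) (c : ℂ) :
    annihAlg v (algebraMap ℂ (ExteriorAlgebra ℂ K) c) = 0 :=
  CliffordAlgebra.contractLeft_algebraMap (Q := (0 : QuadraticForm ℂ K)) _ c

theorem annihAlg_annihAlg (v : K) (x : ExteriorAlgebra ℂ K) : annihAlg v (annihAlg v x) = 0 :=
  CliffordAlgebra.contractLeft_contractLeft (Q := (0 : QuadraticForm ℂ K)) _ x

theorem annihAlg_smul (c : ℂ) (v : K) : annihAlg (c • v) = conj c • annihAlg v := by
  simp [annihAlg]

theorem annihAlg_add (v w : K) : annihAlg (v + w) = annihAlg v + annihAlg w := by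
  simp [annihAlg]

/-- Transpose of annihilation on antilinear functionals; it is complex linear in `v`. -/
def annihTranspose :
    K →ₗ[ℂ] Module.End ℂ (ExteriorAlgebra ℂ K →ₗ⋆[ℂ] ℂ) where
  toFun v :=
    { toFun := fun f => f.comp (annihAlg v)
      map_add' := fun _ _ => rfl
      map_smul' := fun _ _ => rfl }
  map_add' v w := by ext f x; simp [annihAlg_add]
  map_smul' c v := by ext f x; simp [annihAlg_smul]

/-- The antilinear functional that takes the conjugate of the degree zero component. -/
def vacFunctional : ExteriorAlgebra ℂ K →ₗ⋆[ℂ] ℂ where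
  toFun y := conj (ExteriorAlgebra.algebraMapInv y)
  map_add' _ _ := by simp
  map_smul' _ _ := by simp

/-- The functional `y ↦ ⟪y, x⟫` on the exterior algebra, determined by
`gramForm 1 = vacFunctional` and `gramForm (ι v * x) y = gramForm x (annihAlg v y)`. -/
def gramForm (x : ExteriorAlgebra ℂ K) : ExteriorAlgebra ℂ K →ₗ⋆[ℂ] ℂ :=
  ExteriorAlgebra.lift ℂ ⟨annihTranspose, fun v => by
    ext f x
    simp [annihTranspose, annihAlg_annihAlg]⟩ x vacFunctional

theorem gramForm_add (x x' y : ExteriorAlgebra ℂ K) :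
    gramForm (x + x') y = gramForm x y + gramForm x' y := by
  simp [gramForm]

theorem gramForm_smul (c : ℂ) (x y : ExteriorAlgebra ℂ K) :
    gramForm (c • x) y = c * gramForm x y := by
  simp [gramForm]

theorem gramForm_algebraMap (c : ℂ) (y : ExteriorAlgebra ℂ K) :
    gramForm (algebraMap ℂ _ c) y = c * conj (ExteriorAlgebra.algebraMapInv y) := by
  simp [gramForm, Algebra.algebraMap_eq_smul_one, vacFunctional]

theorem gramForm_ι_mul (v : K) (x y : ExteriorAlgebra ℂ K) :
    gramForm (ExteriorAlgebra.ι ℂ v * x) y = gramForm x (annihAlg v y) := by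
  simp only [gramForm, map_mul, ExteriorAlgebra.lift_ι_apply]
  rfl

theorem gramForm_mul_right (v : K) (x : ExteriorAlgebra ℂ K) :
    ∀ y, gramForm x (ExteriorAlgebra.ι ℂ v * y) = gramForm (annihAlg v x) y := by
  induction x using CliffordAlgebra.left_induction with
  | algebraMap c =>
    intro y
    have h := gramForm_algebraMap (K := K) c (ExteriorAlgebra.ι ℂ v * y)
    have h2 := annihAlg_algebraMap (K := K) v c
    change gramForm (algebraMap ℂ (ExteriorAlgebra ℂ K) c) _
      = gramForm (annihAlg v (algebraMap ℂ (ExteriorAlgebra ℂ K) c)) y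
    rw [h, h2]
    simp [gramForm, ExteriorAlgebra.algebraMapInv]
  | add x x' hx hx' =>
    intro y
    rw [gramForm_add, map_add, gramForm_add, hx, hx']
  | ι_mul x u hx =>
    intro y
    change gramForm (ExteriorAlgebra.ι ℂ u * x) _ = gramForm (annihAlg v (ExteriorAlgebra.ι ℂ u * x)) y
    rw [gramForm_ι_mul, annihAlg_ι_mul, annihAlg_ι_mul, map_sub, hx, sub_eq_add_neg, sub_eq_add_neg,
      gramForm_add, ← neg_one_smul ℂ (ExteriorAlgebra.ι ℂ u * _), gramForm_smul, gramForm_smul,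
      gramForm_ι_mul]
    simp

theorem gramForm_conj (x : ExteriorAlgebra ℂ K) : ∀ y, conj (gramForm y x) = gramForm x y := by
  induction x using CliffordAlgebra.left_induction with
  | algebraMap c =>
    intro y
    change conj (gramForm y (algebraMap ℂ (ExteriorAlgebra ℂ K) c))
      = gramForm (algebraMap ℂ (ExteriorAlgebra ℂ K) c) y
    rw [gramForm_algebraMap]
    induction y using CliffordAlgebra.left_induction with
    | algebraMap d =>
      change conj (gramForm (algebraMap ℂ (ExteriorAlgebra ℂ K) d) _)
        = c * conj (ExteriorAlgebra.algebraMapInv (algebraMap ℂ (ExteriorAlgebra ℂ K) d))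
      rw [gramForm_algebraMap]
      simp [mul_comm]
    | add y y' hy hy' => simp only [gramForm_add, map_add, hy, hy', mul_add]
    | ι_mul y u hy =>
      change conj (gramForm (ExteriorAlgebra.ι ℂ u * y) _)
        = c * conj (ExteriorAlgebra.algebraMapInv (ExteriorAlgebra.ι ℂ u * y))
      rw [gramForm_ι_mul, annihAlg_algebraMap]
      simp [ExteriorAlgebra.algebraMapInv]
  | add x x' hx hx' =>
    intro y
    rw [gramForm_add, map_add, map_add, hx, hx']
  | ι_mul x u hx =>
    intro y
    change conj (gramForm y (ExteriorAlgebra.ι ℂ u * x)) = gramForm (ExteriorAlgebra.ι ℂ u * x) y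
    rw [gramForm_mul_right, gramForm_ι_mul, hx]

theorem annihAlg_map_eq_zero (V : Submodule ℂ K) (e : K) (he : ∀ v ∈ V, ⟪e, v⟫_ℂ = 0)
    (z : ExteriorAlgebra ℂ V) : annihAlg e (ExteriorAlgebra.map V.subtype z) = 0 := by
  induction z using CliffordAlgebra.left_induction with
  | algebraMap c =>
    change annihAlg e (ExteriorAlgebra.map V.subtype (algebraMap ℂ (ExteriorAlgebra ℂ V) c)) = 0
    rw [AlgHom.commutes, annihAlg_algebraMap]
  | add x y hx hy => rw [map_add, map_add, hx, hy, add_zero]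
  | ι_mul x u hx =>
    change annihAlg e (ExteriorAlgebra.map V.subtype (ExteriorAlgebra.ι ℂ u * x)) = 0
    rw [map_mul, ExteriorAlgebra.map_apply_ι, annihAlg_ι_mul, hx]
    simp [he u u.2]

theorem exists_decomp (s : Set K) (e : K) (z : ExteriorAlgebra ℂ (Submodule.span ℂ (insert e s))) :
    ∃ a b : ExteriorAlgebra ℂ (Submodule.span ℂ s),
      ExteriorAlgebra.map (Submodule.span ℂ (insert e s)).subtype z
        = ExteriorAlgebra.map (Submodule.span ℂ s).subtype a
          + ExteriorAlgebra.ι ℂ e * ExteriorAlgebra.map (Submodule.span ℂ s).subtype b := by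
  induction z using CliffordAlgebra.left_induction with
  | algebraMap c =>
    refine ⟨algebraMap ℂ _ c, 0, ?_⟩
    change ExteriorAlgebra.map _ (algebraMap ℂ (ExteriorAlgebra ℂ _) c) = _
    simp
  | add x y hx hy =>
    obtain ⟨a, b, h⟩ := hx
    obtain ⟨a', b', h'⟩ := hy
    refine ⟨a + a', b + b', ?_⟩
    rw [map_add, h, h', map_add, map_add, mul_add]
    abel
  | ι_mul x u hx =>
    obtain ⟨a, b, h⟩ := hx
    obtain ⟨c, v, hv, hu⟩ := Submodule.mem_span_insert.1 u.2
    refine ⟨ExteriorAlgebra.ι ℂ ⟨v, hv⟩ * a, c • a - ExteriorAlgebra.ι ℂ ⟨v, hv⟩ * b, ?_⟩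
    change ExteriorAlgebra.map _ (ExteriorAlgebra.ι ℂ u * x) = _
    have hanti : ExteriorAlgebra.ι ℂ v * ExteriorAlgebra.ι ℂ e
        = - (ExteriorAlgebra.ι ℂ e * ExteriorAlgebra.ι ℂ v) :=
      eq_neg_of_add_eq_zero_left (ExteriorAlgebra.ι_add_mul_swap v e)
    have hsq : ExteriorAlgebra.ι ℂ e * ExteriorAlgebra.ι ℂ e = 0 := ExteriorAlgebra.ι_sq_zero e
    simp only [map_mul, ExteriorAlgebra.map_apply_ι, h, Submodule.subtype_apply, hu, map_add,
      map_smul, map_sub, mul_add, add_mul, mul_sub, ← mul_assoc, hanti, smul_mul_assoc, hsq,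
      mul_smul_comm, neg_mul, zero_mul, smul_zero]
    abel

theorem gramForm_self_nonneg_of_orthonormal (s : Finset K) :
    Orthonormal ℂ ((↑) : s → K) → ∀ z : ExteriorAlgebra ℂ (Submodule.span ℂ (s : Set K)),
      0 ≤ gramForm (ExteriorAlgebra.map (Submodule.span ℂ (s : Set K)).subtype z)
        (ExteriorAlgebra.map (Submodule.span ℂ (s : Set K)).subtype z) := by
  classical
  induction s using Finset.induction_on with
  | empty =>
    intro _ z
    have hz : ∃ c : ℂ, ExteriorAlgebra.map (Submodule.span ℂ ((∅ : Finset K) : Set K)).subtype z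
        = algebraMap ℂ _ c := by
      induction z using CliffordAlgebra.left_induction with
      | algebraMap c => exact ⟨c, AlgHom.commutes _ c⟩
      | add x y hx hy =>
        obtain ⟨a, ha⟩ := hx
        obtain ⟨b, hb⟩ := hy
        exact ⟨a + b, by rw [map_add, ha, hb, map_add]⟩
      | ι_mul x u hx =>
        refine ⟨0, ?_⟩
        have hu : (u : K) = 0 := by simpa using u.2
        change ExteriorAlgebra.map _ (ExteriorAlgebra.ι ℂ u * x) = _
        rw [map_mul, ExteriorAlgebra.map_apply_ι, Submodule.subtype_apply, hu]
        simp
    obtain ⟨c, hc⟩ := hz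
    rw [hc, gramForm_algebraMap, ExteriorAlgebra.algebraMap_leftInverse]
    rw [Complex.mul_conj]
    exact_mod_cast Complex.normSq_nonneg c
  | insert e s hes ih =>
    intro hon z
    have hon' : Orthonormal ℂ ((↑) : s → K) :=
      hon.comp (fun x : s => (⟨x, Finset.mem_insert_of_mem x.2⟩ : (insert e s : Finset K)))
        (fun x y h => Subtype.ext (Subtype.mk.inj h))
    have he : ∀ v ∈ Submodule.span ℂ (s : Set K), ⟪e, v⟫_ℂ = 0 := by
      intro v hv
      induction hv using Submodule.span_induction with
      | mem x hx =>
        exact hon.2 (i := ⟨e, Finset.mem_insert_self e s⟩)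
          (j := ⟨x, Finset.mem_insert_of_mem hx⟩)
          (fun h => hes (by rw [Subtype.mk.injEq] at h; rw [h]; exact hx))
      | zero => simp
      | add x y _ _ hx hy => rw [inner_add_right, hx, hy, add_zero]
      | smul c x _ hx => rw [inner_smul_right, hx, mul_zero]
    have hee : ⟪e, e⟫_ℂ = 1 := by
      have := hon.1 ⟨e, Finset.mem_insert_self e s⟩
      rw [inner_self_eq_norm_sq_to_K]
      simp only at this
      rw [this]
      simp
    have hins : ((insert e s : Finset K) : Set K) = insert e (s : Set K) := Finset.coe_insert e s
    have hdec : ∃ a b : ExteriorAlgebra ℂ (Submodule.span ℂ (s : Set K)),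
        ExteriorAlgebra.map (Submodule.span ℂ ((insert e s : Finset K) : Set K)).subtype z
        = ExteriorAlgebra.map (Submodule.span ℂ (s : Set K)).subtype a
          + ExteriorAlgebra.ι ℂ e
            * ExteriorAlgebra.map (Submodule.span ℂ (s : Set K)).subtype b := by
      revert z
      rw [hins]
      exact exists_decomp (s : Set K) e
    obtain ⟨a, b, hab⟩ := hdec
    rw [hab, gramForm_add, map_add, map_add, gramForm_ι_mul, gramForm_ι_mul, gramForm_mul_right,
      annihAlg_ι_mul, annihAlg_map_eq_zero _ e he, annihAlg_map_eq_zero _ e he, hee]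
    have h0 : gramForm (0 : ExteriorAlgebra ℂ K)
        (ExteriorAlgebra.map (Submodule.span ℂ (s : Set K)).subtype b) = 0 := by
      simp [gramForm]
    rw [h0]
    simpa using add_nonneg (ih hon' a) (ih hon' b)

theorem exists_finiteDimensional (x : ExteriorAlgebra ℂ K) :
    ∃ V : Submodule ℂ K, FiniteDimensional ℂ V ∧
      ∃ z : ExteriorAlgebra ℂ V, ExteriorAlgebra.map V.subtype z = x := by
  have mono : ∀ (V W : Submodule ℂ K) (_ : V ≤ W) (z : ExteriorAlgebra ℂ V),
      ∃ z' : ExteriorAlgebra ℂ W, ExteriorAlgebra.map W.subtype z'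
        = ExteriorAlgebra.map V.subtype z := by
    intro V W h z
    refine ⟨ExteriorAlgebra.map (Submodule.inclusion h) z, ?_⟩
    rw [← AlgHom.comp_apply, ExteriorAlgebra.map_comp_map, Submodule.subtype_comp_inclusion]
  induction x using CliffordAlgebra.left_induction with
  | algebraMap c => exact ⟨⊥, inferInstance, algebraMap ℂ _ c, AlgHom.commutes _ c⟩
  | add x y hx hy =>
    obtain ⟨V, hV, z, rfl⟩ := hx
    obtain ⟨W, hW, w, rfl⟩ := hy
    obtain ⟨z', hz⟩ := mono V (V ⊔ W) le_sup_left z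
    obtain ⟨w', hw⟩ := mono W (V ⊔ W) le_sup_right w
    exact ⟨V ⊔ W, inferInstance, z' + w', by rw [map_add, hz, hw]⟩
  | ι_mul x u hx =>
    obtain ⟨V, hV, z, rfl⟩ := hx
    obtain ⟨z', hz⟩ := mono V (V ⊔ ℂ ∙ u) le_sup_left z
    refine ⟨V ⊔ ℂ ∙ u, inferInstance, ExteriorAlgebra.ι ℂ
      ⟨u, Submodule.mem_sup_right (Submodule.mem_span_singleton_self u)⟩ * z', ?_⟩
    rw [map_mul, hz, ExteriorAlgebra.map_apply_ι]
    rfl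

theorem gramForm_self_nonneg (x : ExteriorAlgebra ℂ K) : 0 ≤ gramForm x x := by
  classical
  obtain ⟨V, hV, z, rfl⟩ := exists_finiteDimensional x
  obtain ⟨s, b, hb⟩ := exists_orthonormalBasis ℂ V
  have hspan : Submodule.span ℂ ((s.map ⟨((↑) : V → K), Subtype.val_injective⟩ : Finset K) : Set K)
      = V := by
    have h1 := b.toBasis.span_eq
    rw [OrthonormalBasis.coe_toBasis, hb, Subtype.range_coe] at h1
    have h2 := congrArg (Submodule.map V.subtype) h1
    rw [Submodule.map_span, Submodule.map_top, Submodule.range_subtype] at h2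
    simpa using h2
  have hon : Orthonormal ℂ
      ((↑) : (s.map ⟨((↑) : V → K), Subtype.val_injective⟩ : Finset K) → K) := by
    have h1 : Orthonormal ℂ (fun i : s => ((i : V) : K)) := by
      have := b.orthonormal.comp_linearIsometry V.subtypeₗᵢ
      rw [hb] at this
      exact this
    let f : (s.map ⟨((↑) : V → K), Subtype.val_injective⟩ : Finset K) → s := fun x =>
      ⟨⟨x, by obtain ⟨y, _, hy⟩ := Finset.mem_map.1 x.2; rw [← hy]; exact y.2⟩, by
        obtain ⟨y, hy1, hy⟩ := Finset.mem_map.1 x.2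
        have hxy : (⟨x, by rw [← hy]; exact y.2⟩ : V) = y := Subtype.ext hy.symm
        rw [hxy]
        exact hy1⟩
    exact h1.comp f (fun x y h => by
      have := congrArg (fun i : s => ((i : V) : K)) h
      exact Subtype.ext this)
  have key := gramForm_self_nonneg_of_orthonormal _ hon
  rw [hspan] at key
  exact key z

/-- The inner product on the exterior algebra: it is determined by `⟪1, 1⟫ = 1`, `⟪1, ι v * y⟫ = 0`
and by left multiplication with `ι v` being adjoint to `annihAlg v`. Components of different degree
are orthogonal and `⟪v₁ ∧ ⋯ ∧ vₙ, w₁ ∧ ⋯ ∧ wₙ⟫ = det ⟪vᵢ, wⱼ⟫`. -/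
instance instCore : PreInnerProductSpace.Core ℂ (ExteriorAlgebra ℂ K) where
  inner x y := gramForm y x
  conj_inner_symm x y := gramForm_conj y x
  re_inner_nonneg x := (Complex.le_def.1 (gramForm_self_nonneg x)).1
  add_left x y z := by simp
  smul_left x y c := by simp

instance instSeminormed : SeminormedAddCommGroup (ExteriorAlgebra ℂ K) :=
  InnerProductSpace.Core.toSeminormedAddCommGroup (𝕜 := ℂ)

instance instInner : InnerProductSpace ℂ (ExteriorAlgebra ℂ K) :=
  InnerProductSpace.ofCore _

theorem inner_ι_mul_left (v : K) (x y : ExteriorAlgebra ℂ K) :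
    ⟪ExteriorAlgebra.ι ℂ v * x, y⟫_ℂ = ⟪x, annihAlg v y⟫_ℂ :=
  gramForm_mul_right v y x

theorem norm_createAlg_le (v : K) (x : ExteriorAlgebra ℂ K) :
    ‖createAlg v x‖ ≤ ‖v‖ * ‖x‖ := by
  have h1 : ⟪createAlg v x, createAlg v x⟫_ℂ
      = ⟪v, v⟫_ℂ * ⟪x, x⟫_ℂ - ⟪annihAlg v x, annihAlg v x⟫_ℂ := by
    simp only [createAlg, LinearMap.mulLeft_apply]
    rw [inner_ι_mul_left, annihAlg_ι_mul, inner_sub_right, inner_smul_right]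
    congr 1
    rw [← inner_conj_symm, inner_ι_mul_left, inner_conj_symm]
  have h2 : ‖createAlg v x‖ ^ 2 = ‖v‖ ^ 2 * ‖x‖ ^ 2 - ‖annihAlg v x‖ ^ 2 := by
    simp only [inner_self_eq_norm_sq_to_K] at h1
    exact_mod_cast h1
  refine (sq_le_sq₀ (norm_nonneg _) (by positivity)).1 ?_
  nlinarith [sq_nonneg ‖annihAlg v x‖]

end Algebraic

section Fock

variable (K : Type u) [NormedAddCommGroup K] [InnerProductSpace ℂ K]

/-- The antisymmetric (fermionic) Fock space over `K`: the Hilbert space completion of the exterior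
algebra over `K`. -/
def Fock : Type u := UniformSpace.Completion (ExteriorAlgebra ℂ K)

instance instFockNormed : NormedAddCommGroup (Fock K) :=
  inferInstanceAs (NormedAddCommGroup (UniformSpace.Completion (ExteriorAlgebra ℂ K)))

instance instFockInner : InnerProductSpace ℂ (Fock K) :=
  inferInstanceAs (InnerProductSpace ℂ (UniformSpace.Completion (ExteriorAlgebra ℂ K)))

instance instFockComplete : CompleteSpace (Fock K) :=
  inferInstanceAs (CompleteSpace (UniformSpace.Completion (ExteriorAlgebra ℂ K)))

variable {K}

/-- The canonical isometric map of the exterior algebra onto a dense subspace of Fock space. -/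
def toFock : ExteriorAlgebra ℂ K →ₗᵢ[ℂ] Fock K :=
  UniformSpace.Completion.toComplₗᵢ (𝕜 := ℂ) (E := ExteriorAlgebra ℂ K)

theorem denseRange_toFock : DenseRange (toFock (K := K)) :=
  UniformSpace.Completion.denseRange_coe (α := ExteriorAlgebra ℂ K)

variable (K) in
/-- The vacuum vector. -/
def vacuum : Fock K := toFock 1

/-- The creation operator `a*(ψ)`, complex linear in `ψ`: the continuous extension of `x ↦ ψ ∧ x`. -/
def creation (ψ : K) : Fock K →L[ℂ] Fock K :=
  ContinuousLinearMap.completion ((createAlg ψ).mkContinuous ‖ψ‖ (norm_createAlg_le ψ))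

theorem creation_toFock (ψ : K) (x : ExteriorAlgebra ℂ K) :
    creation ψ (toFock x) = toFock (ExteriorAlgebra.ι ℂ ψ * x) :=
  ContinuousLinearMap.completion_apply_coe
    ((createAlg ψ).mkContinuous ‖ψ‖ (norm_createAlg_le ψ)) x

attribute [irreducible] Fock instFockNormed instFockInner toFock creation

/-- The annihilation operator `a(ψ)`, the adjoint of `a*(ψ)`. -/
def annihilation (ψ : K) : Fock K →L[ℂ] Fock K :=
  ContinuousLinearMap.adjoint (creation ψ)

/-- The fermionic field operator `φ(ψ) = a*(ψ) + a(ψ)`. -/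
def field (ψ : K) : Fock K →L[ℂ] Fock K := creation ψ + annihilation ψ

theorem star_field (ψ : K) : star (field ψ) = field ψ := by
  rw [ContinuousLinearMap.star_eq_adjoint]
  simp [field, annihilation, add_comm]

/-- The von Neumann algebra `{φ(ψ) : ψ ∈ L}''` generated by the field operators. -/
def fieldAlgebra (L : Submodule ℝ K) : VonNeumannAlgebra (Fock K) where
  toStarSubalgebra := StarSubalgebra.centralizer ℂ
    (StarSubalgebra.centralizer ℂ (field '' (L : Set K)) : Set (Fock K →L[ℂ] Fock K))
  centralizer_centralizer' := by simp

theorem coe_fieldAlgebra (L : Submodule ℝ K) :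
    (fieldAlgebra L : Set (Fock K →L[ℂ] Fock K))
      = Set.centralizer (Set.centralizer (field '' (L : Set K))) := by
  have hstar : star (field '' (L : Set K)) = field '' (L : Set K) := by
    ext A
    simp only [Set.mem_star, Set.mem_image]
    constructor
    · rintro ⟨ψ, hψ, h⟩
      exact ⟨ψ, hψ, by rw [← star_field, h, star_star]⟩
    · rintro ⟨ψ, hψ, h⟩
      exact ⟨ψ, hψ, by rw [← star_field, h]⟩
  have h1 : (StarSubalgebra.centralizer ℂ (field '' (L : Set K)) : Set (Fock K →L[ℂ] Fock K))
      = Set.centralizer (field '' (L : Set K)) := by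
    rw [StarSubalgebra.coe_centralizer, hstar, Set.union_self]
  have h2 : (fieldAlgebra L : Set (Fock K →L[ℂ] Fock K))
      = (StarSubalgebra.centralizer ℂ (StarSubalgebra.centralizer ℂ (field '' (L : Set K)) :
          Set (Fock K →L[ℂ] Fock K)) : Set (Fock K →L[ℂ] Fock K)) := rfl
  have h3 : star (StarSubalgebra.centralizer ℂ (field '' (L : Set K)) :
      Set (Fock K →L[ℂ] Fock K)) = StarSubalgebra.centralizer ℂ (field '' (L : Set K)) := by
    ext A
    exact star_mem_iff (s := StarSubalgebra.centralizer ℂ (field '' (L : Set K)))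
  rw [h2, StarSubalgebra.coe_centralizer, h3, Set.union_self, h1]

/-- On the exterior algebra, `⊕ₙ X^{⊗n}` has as its graph the span of the pairs
`(ξ₁ ∧ ⋯ ∧ ξₙ, X ξ₁ ∧ ⋯ ∧ X ξₙ)`, `ξᵢ ∈ dom X`, `n ≥ 0`. -/
def secondQuantizationGraph (X : K →ₗ.[ℂ] K) : Submodule ℂ (Fock K × Fock K) :=
  LinearMap.range
    ((toFock.toLinearMap ∘ₗ (ExteriorAlgebra.map X.domain.subtype).toLinearMap).prod
      (toFock.toLinearMap ∘ₗ (ExteriorAlgebra.map X.toFun).toLinearMap))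

/-- The second quantization `⊕ₙ X^{⊗n}` on the antisymmetric Fock space, as a closed operator. -/
def secondQuantization (X : K →ₗ.[ℂ] K) : Fock K →ₗ.[ℂ] Fock K :=
  (secondQuantizationGraph X).topologicalClosure.toLinearPMap

/-- `X` is densely defined and `⟪ψ, X ψ⟫ > 0` for all nonzero `ψ ∈ dom X`; in particular `X` is
symmetric and injective. -/
def IsStrictlyPositiveOp (X : K →ₗ.[ℂ] K) : Prop :=
  Dense (X.domain : Set K) ∧ ∀ ψ : X.domain, ψ ≠ 0 → 0 < ⟪(ψ : K), X ψ⟫_ℂ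

/-- `Γ` is an antilinear involution with `Γ = Γ* = Γ⁻¹`, where the adjoint of an antilinear map is
given by `⟪Γ ψ, χ⟫ = conj ⟪ψ, Γ* χ⟫`. -/
def IsAntilinearInvolution (Γ : K →ₗ⋆[ℂ] K) : Prop :=
  (∀ ψ, Γ (Γ ψ) = ψ) ∧ ∀ ψ χ, ⟪Γ ψ, χ⟫_ℂ = conj ⟪ψ, Γ χ⟫_ℂ

/-- `X` commutes with `Γ`: `Γ` preserves `dom X` and `X Γ ψ = Γ X ψ` there. -/
def CommutesWith (X : K →ₗ.[ℂ] K) (Γ : K →ₗ⋆[ℂ] K) : Prop :=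
  ∀ ψ : X.domain, ∃ h : Γ ψ ∈ X.domain, X ⟨Γ ψ, h⟩ = Γ (X ψ)

/-- The real linear subspace `(1 + Γ) Lφ + (1 - Γ) Lπ`. -/
def realSubspace (Γ : K →ₗ⋆[ℂ] K) (Lφ Lπ : Submodule ℂ K) : Submodule ℝ K where
  carrier := {ψ | ∃ f ∈ Lφ, ∃ g ∈ Lπ, ψ = (f + Γ f) + (g - Γ g)}
  zero_mem' := ⟨0, Lφ.zero_mem, 0, Lπ.zero_mem, by simp⟩
  add_mem' := by
    rintro _ _ ⟨f, hf, g, hg, rfl⟩ ⟨f', hf', g', hg', rfl⟩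
    refine ⟨f + f', Lφ.add_mem hf hf', g + g', Lπ.add_mem hg hg', ?_⟩
    simp only [map_add]
    abel
  smul_mem' := by
    rintro c _ ⟨f, hf, g, hg, rfl⟩
    refine ⟨(c : ℂ) • f, Lφ.smul_mem _ hf, (c : ℂ) • g, Lπ.smul_mem _ hg, ?_⟩
    rw [LinearMap.map_smulₛₗ, LinearMap.map_smulₛₗ]
    simp only [Complex.conj_ofReal, Complex.coe_smul, smul_add, smul_sub]

/-- The map `Ξ(A) = X A Ω` on the von Neumann algebra generated by the fields over `L`, where `X`
stands for its second quantization. -/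
def nuclearityMap (X : K →ₗ.[ℂ] K) (L : Submodule ℝ K)
    (h : ∀ A ∈ fieldAlgebra L, A (vacuum K) ∈ (secondQuantization X).domain) :
    (fieldAlgebra L).toStarSubalgebra →ₗ[ℂ] Fock K where
  toFun A := secondQuantization X ⟨(A : Fock K →L[ℂ] Fock K) (vacuum K), h A A.2⟩
  map_add' A B := by
    rw [← LinearPMap.map_add]
    rfl
  map_smul' c A := by
    rw [RingHom.id_apply, ← LinearPMap.map_smul]
    rfl

end Fock

section WellDefined

variable {K : Type u} [NormedAddCommGroup K] [InnerProductSpace ℂ K]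

theorem IsStrictlyPositiveOp.symm {X : K →ₗ.[ℂ] K} (hX : IsStrictlyPositiveOp X)
    (ψ χ : X.domain) : ⟪X ψ, (χ : K)⟫_ℂ = ⟪(ψ : K), X χ⟫_ℂ := by
  have hr : ∀ ψ : X.domain, ⟪X ψ, (ψ : K)⟫_ℂ = ⟪(ψ : K), X ψ⟫_ℂ := by
    intro ψ
    by_cases h : ψ = 0
    · simp [h]
    · have h1 := (Complex.lt_def.1 (hX.2 ψ h)).2
      rw [← inner_conj_symm, Complex.conj_eq_iff_im]
      exact h1.symm
  have h1 := hr (ψ + χ)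
  have h2 := hr (ψ + Complex.I • χ)
  simp only [LinearPMap.map_add, LinearPMap.map_smul, Submodule.coe_add, Submodule.coe_smul,
    inner_add_left, inner_add_right, inner_smul_left, inner_smul_right, hr, Complex.conj_I] at h1 h2
  linear_combination (1 / 2 : ℂ) * h1 + (-Complex.I / 2) * h2
    + (1 / 2 : ℂ) * (⟪X ψ, (χ : K)⟫_ℂ - ⟪X χ, (ψ : K)⟫_ℂ - ⟪(ψ : K), X χ⟫_ℂ + ⟪(χ : K), X ψ⟫_ℂ)
      * Complex.I_sq

theorem contract_map {V : Submodule ℂ K} (f : V →ₗ[ℂ] K) (g : V →ₗ[ℂ] K) (v w : K)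
    (hvw : ∀ x, ⟪v, f x⟫_ℂ = ⟪w, g x⟫_ℂ) (z : ExteriorAlgebra ℂ V) :
    ∃ z', annihAlg v (ExteriorAlgebra.map f z) = ExteriorAlgebra.map f z' ∧
      annihAlg w (ExteriorAlgebra.map g z) = ExteriorAlgebra.map g z' := by
  induction z using CliffordAlgebra.left_induction with
  | algebraMap c =>
    refine ⟨0, ?_, ?_⟩
    · change annihAlg v (ExteriorAlgebra.map f (algebraMap ℂ (ExteriorAlgebra ℂ V) c)) = _
      rw [AlgHom.commutes, annihAlg_algebraMap, map_zero]
    · change annihAlg w (ExteriorAlgebra.map g (algebraMap ℂ (ExteriorAlgebra ℂ V) c)) = _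
      rw [AlgHom.commutes, annihAlg_algebraMap, map_zero]
  | add x y hx hy =>
    obtain ⟨a, ha, ha'⟩ := hx
    obtain ⟨b, hb, hb'⟩ := hy
    exact ⟨a + b, by rw [map_add, map_add, ha, hb, map_add],
      by rw [map_add, map_add, ha', hb', map_add]⟩
  | ι_mul x u hx =>
    obtain ⟨a, ha, ha'⟩ := hx
    refine ⟨⟪v, f u⟫_ℂ • x - ExteriorAlgebra.ι ℂ u * a, ?_, ?_⟩
    · change annihAlg v (ExteriorAlgebra.map f (ExteriorAlgebra.ι ℂ u * x)) = _
      rw [map_mul, ExteriorAlgebra.map_apply_ι, annihAlg_ι_mul, ha, map_sub, map_smul, map_mul,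
        ExteriorAlgebra.map_apply_ι]
    · change annihAlg w (ExteriorAlgebra.map g (ExteriorAlgebra.ι ℂ u * x)) = _
      rw [map_mul, ExteriorAlgebra.map_apply_ι, annihAlg_ι_mul, ha', map_sub, map_smul, map_mul,
        ExteriorAlgebra.map_apply_ι, hvw]

theorem inner_map_symm {X : K →ₗ.[ℂ] K} (hX : IsStrictlyPositiveOp X)
    (z : ExteriorAlgebra ℂ X.domain) : ∀ w : ExteriorAlgebra ℂ X.domain,
    ⟪ExteriorAlgebra.map X.toFun z, ExteriorAlgebra.map X.domain.subtype w⟫_ℂ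
      = ⟪ExteriorAlgebra.map X.domain.subtype z, ExteriorAlgebra.map X.toFun w⟫_ℂ := by
  induction z using CliffordAlgebra.left_induction with
  | algebraMap c =>
    intro w
    change ⟪ExteriorAlgebra.map X.toFun (algebraMap ℂ (ExteriorAlgebra ℂ X.domain) c), _⟫_ℂ
      = ⟪ExteriorAlgebra.map X.domain.subtype (algebraMap ℂ (ExteriorAlgebra ℂ X.domain) c), _⟫_ℂ
    rw [AlgHom.commutes, AlgHom.commutes, ← inner_conj_symm, ← inner_conj_symm _
      (ExteriorAlgebra.map X.toFun w)]
    congr 1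
    change gramForm _ _ = gramForm _ _
    rw [gramForm_algebraMap, gramForm_algebraMap]
    have h : ∀ f : X.domain →ₗ[ℂ] K,
        ExteriorAlgebra.algebraMapInv.comp (ExteriorAlgebra.map f)
          = ExteriorAlgebra.algebraMapInv := by
      intro f
      ext x
      simp [ExteriorAlgebra.algebraMapInv]
    rw [← AlgHom.comp_apply, ← AlgHom.comp_apply, h, h]
  | add x y hx hy =>
    intro w
    rw [map_add, map_add, inner_add_left, inner_add_left, hx, hy]
  | ι_mul x u hx =>
    intro w
    change ⟪ExteriorAlgebra.map X.toFun (ExteriorAlgebra.ι ℂ u * x), _⟫_ℂ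
      = ⟪ExteriorAlgebra.map X.domain.subtype (ExteriorAlgebra.ι ℂ u * x), _⟫_ℂ
    rw [map_mul, map_mul, ExteriorAlgebra.map_apply_ι, ExteriorAlgebra.map_apply_ι,
      inner_ι_mul_left, inner_ι_mul_left]
    obtain ⟨w', h1, h2⟩ := contract_map X.domain.subtype X.toFun (X.toFun u) (X.domain.subtype u)
      (fun x => hX.symm u x) w
    rw [h1, h2, hx]

theorem dense_map_domain {V : Submodule ℂ K} (hV : Dense (V : Set K)) (x : ExteriorAlgebra ℂ K) :
    x ∈ (LinearMap.range (ExteriorAlgebra.map V.subtype).toLinearMap).topologicalClosure := by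
  set R := LinearMap.range (ExteriorAlgebra.map V.subtype).toLinearMap with hR
  induction x using CliffordAlgebra.left_induction with
  | algebraMap c =>
    exact R.le_topologicalClosure ⟨algebraMap ℂ _ c, AlgHom.commutes _ c⟩
  | add x y hx hy => exact add_mem hx hy
  | ι_mul x u hx =>
    have h1 : ∀ v ∈ V, ∀ y ∈ R.topologicalClosure,
        ExteriorAlgebra.ι ℂ v * y ∈ R.topologicalClosure := by
      intro v hv y hy
      have hc := ((createAlg v).mkContinuous ‖v‖ (norm_createAlg_le v)).continuous
      have hm : Set.MapsTo ((createAlg v).mkContinuous ‖v‖ (norm_createAlg_le v))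
          (R : Set (ExteriorAlgebra ℂ K)) R := by
        rintro _ ⟨z, rfl⟩
        exact ⟨ExteriorAlgebra.ι ℂ ⟨v, hv⟩ * z, by
          simp [createAlg]⟩
      exact hm.closure hc hy
    have hlin : Continuous fun v : K => ExteriorAlgebra.ι ℂ v * x :=
      (LinearMap.mkContinuous ((LinearMap.mulRight ℂ x).comp (ExteriorAlgebra.ι ℂ)) ‖x‖
        (fun v => by rw [mul_comm]; exact norm_createAlg_le v x)).continuous
    have hm : Set.MapsTo (fun v : K => ExteriorAlgebra.ι ℂ v * x) (V : Set K)
        (R.topologicalClosure : Set (ExteriorAlgebra ℂ K)) := fun v hv => h1 v hv x hx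
    have := hm.closure hlin (hV u)
    rwa [R.isClosed_topologicalClosure.closure_eq] at this

/-- For a strictly positive `X`, the closure that defines the second quantization is the graph of an
operator. -/
theorem graph_secondQuantization {X : K →ₗ.[ℂ] K} (hX : IsStrictlyPositiveOp X) :
    (secondQuantization X).graph = (secondQuantizationGraph X).topologicalClosure := by
  refine Submodule.toLinearPMap_graph_eq _ ?_
  rintro ⟨x, y⟩ hxy hx
  change x = 0 at hx
  subst hx
  change y = 0
  have horth : ∀ w : ExteriorAlgebra ℂ X.domain,
      ⟪toFock (ExteriorAlgebra.map X.domain.subtype w), y⟫_ℂ = 0 := by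
    intro w
    let S : Set (Fock K × Fock K) := {p |
      ⟪toFock (ExteriorAlgebra.map X.domain.subtype w), p.2⟫_ℂ
        = ⟪toFock (ExteriorAlgebra.map X.toFun w), p.1⟫_ℂ}
    have hS : IsClosed S := isClosed_eq (by fun_prop) (by fun_prop)
    have hsub : (secondQuantizationGraph X : Set (Fock K × Fock K)) ⊆ S := by
      rintro _ ⟨z, rfl⟩
      change ⟪toFock _, toFock (ExteriorAlgebra.map X.toFun z)⟫_ℂ
        = ⟪toFock _, toFock (ExteriorAlgebra.map X.domain.subtype z)⟫_ℂ
      rw [LinearIsometry.inner_map_map, LinearIsometry.inner_map_map, inner_map_symm hX]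
    have := closure_minimal hsub hS hxy
    simpa [S] using this
  have hall : ∀ x : ExteriorAlgebra ℂ K, ⟪toFock x, y⟫_ℂ = 0 := by
    intro x
    have hc : IsClosed {x : ExteriorAlgebra ℂ K | ⟪toFock x, y⟫_ℂ = 0} :=
      isClosed_eq (toFock.continuous.inner continuous_const) continuous_const
    refine closure_minimal ?_ hc (dense_map_domain hX.1 x)
    rintro _ ⟨w, rfl⟩
    exact horth w
  have hy : ∀ z : Fock K, ⟪z, y⟫_ℂ = 0 := fun z =>
    denseRange_toFock.induction_on (p := fun z => ⟪z, y⟫_ℂ = 0) z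
      (isClosed_eq (by fun_prop) continuous_const) hall
  exact inner_self_eq_zero.1 (hy y)

end WellDefined

section Operators

variable {K : Type u} [NormedAddCommGroup K] [InnerProductSpace ℂ K] [CompleteSpace K]

variable (K) in
/-- Some orthonormal basis of the Hilbert space `K`. -/
def onBasis : HilbertBasis (exists_hilbertBasis ℂ K).choose ℂ K :=
  (exists_hilbertBasis ℂ K).choose_spec.choose

/-- `T` is trace class: `|T| = (T* T)^{1/2}` has finite trace. (The summability and the value of the
trace of a positive operator do not depend on the orthonormal basis.) -/
def IsTraceClass (T : K →L[ℂ] K) : Prop :=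
  Summable fun i => (⟪onBasis K i, CFC.abs T (onBasis K i)⟫_ℂ).re

/-- The trace norm `‖T‖₁ = Tr |T|` of a trace class operator. -/
def traceNorm (T : K →L[ℂ] K) : ℝ :=
  ∑' i, (⟪onBasis K i, CFC.abs T (onBasis K i)⟫_ℂ).re

/-- The determinant `det (1 + S) = ∏ⱼ (1 + sⱼ)` for a positive trace class operator `S` with
eigenvalues `sⱼ`, repeated according to multiplicity. (Eigenspaces to nonzero eigenvalues are finite
dimensional, and the factor of the eigenvalue zero is one.) -/
def detOneAdd (S : K →L[ℂ] K) : ℝ :=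
  ∏' s : ℝ, (1 + s) ^ Module.finrank ℂ (Module.End.eigenspace (S : K →ₗ[ℂ] K) (s : ℂ))

/-- The positive operator `(|T₁|² + |T₂|²)^{1/2}`. -/
def sqrtSumSq (T₁ T₂ : K →L[ℂ] K) : K →L[ℂ] K :=
  CFC.sqrt (CFC.abs T₁ ^ 2 + CFC.abs T₂ ^ 2)

end Operators

section Nuclear

variable {E F : Type*} [NormedAddCommGroup E] [NormedSpace ℂ E] [NormedAddCommGroup F]
  [NormedSpace ℂ F]

/-- `Ξ = ∑ₖ ρₖ(·) Ψₖ` with `∑ₖ ‖ρₖ‖ ‖Ψₖ‖ < ∞`. -/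
def IsNuclearRep (Ξ : E →ₗ[ℂ] F) (ρ : ℕ → StrongDual ℂ E) (Ψ : ℕ → F) : Prop :=
  (∀ A, HasSum (fun k => ρ k A • Ψ k) (Ξ A)) ∧ Summable fun k => ‖ρ k‖ * ‖Ψ k‖

/-- A linear map between Banach spaces is nuclear if it has a nuclear representation. -/
def IsNuclear (Ξ : E →ₗ[ℂ] F) : Prop := ∃ ρ Ψ, IsNuclearRep Ξ ρ Ψ

/-- The nuclear norm: the infimum of `∑ₖ ‖ρₖ‖ ‖Ψₖ‖` over all nuclear representations. -/
def nuclearNorm (Ξ : E →ₗ[ℂ] F) : ℝ :=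
  sInf {r | ∃ ρ Ψ, IsNuclearRep Ξ ρ Ψ ∧ r = ∑' k, ‖ρ k‖ * ‖Ψ k‖}

end Nuclear

end FermiFock

end

/- On `A Ω` the annihilation operator `a(ψ)` can be traded for elements of the field algebra: its
local version, of norm at most `(‖Eφ ψ - Eπ ψ‖ + ‖Eφ ψ + Eπ ψ‖) / 2`, has the same anticommutators
with the fields over `L`, so their difference moves past `A` up to parity, and `a(ψ) Ω = 0`.
Iteration bounds `⟪ψ₁ ∧ ⋯ ∧ ψₙ, X A Ω⟫` by
`‖A‖ ∏ᵢ (‖(Tφ - Tπ) ψᵢ‖ + ‖(Tφ + Tπ) ψᵢ‖) ≤ ‖A‖ ∏ᵢ ‖2 T ψᵢ‖`. Expanding `X A Ω` in the wedge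
products of an eigenbasis of `T`, one for each finite set of eigenvectors, and summing over these
sets gives `∏ⱼ (1 + 2 tⱼ) = det (1 + 2T)`. The trace norms satisfy `‖T‖₁ ≤ ‖Tφ‖₁ + ‖Tπ‖₁` because
`T = C* |Tφ| + D* |Tπ|` with contractions `C` and `D`. -/

noncomputable section

namespace FermiFock

universe u

section Exterior

@[elab_as_elim]
theorem exteriorAlgebra_left_induction {R V : Type*} [CommRing R] [AddCommGroup V] [Module R V]
    {motive : ExteriorAlgebra R V → Prop} (x : ExteriorAlgebra R V)
    (algebraMap : ∀ c, motive (algebraMap R (ExteriorAlgebra R V) c))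
    (add : ∀ x y, motive x → motive y → motive (x + y))
    (ι_mul : ∀ x v, motive x → motive (ExteriorAlgebra.ι R v * x)) : motive x :=
  CliffordAlgebra.left_induction (Q := 0) algebraMap add ι_mul x

variable {K K' : Type*} [NormedAddCommGroup K] [InnerProductSpace ℂ K]
  [NormedAddCommGroup K'] [InnerProductSpace ℂ K']
  {V W : Type*} [AddCommGroup V] [Module ℂ V] [AddCommGroup W] [Module ℂ W]

theorem annihAlg_map (f : V →ₗ[ℂ] K) (v : K) (x : ExteriorAlgebra ℂ V) :
    annihAlg v (ExteriorAlgebra.map f x)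
      = ExteriorAlgebra.map f (CliffordAlgebra.contractLeft (Q := 0) (innerₛₗ ℂ v ∘ₗ f) x) := by
  induction x using exteriorAlgebra_left_induction with
  | algebraMap c =>
    rw [AlgHom.commutes, annihAlg_algebraMap]
    exact (map_zero _).symm.trans
      (congrArg _ (CliffordAlgebra.contractLeft_algebraMap (Q := 0) _ c).symm)
  | add x y hx hy => simp only [map_add, hx, hy]
  | ι_mul x w hx =>
    rw [map_mul, ExteriorAlgebra.map_apply_ι, annihAlg_ι_mul, hx]
    refine Eq.trans ?_ (congrArg _ (CliffordAlgebra.contractLeft_ι_mul (Q := 0) _ w x).symm)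
    change _ = ExteriorAlgebra.map f (⟪v, f w⟫_ℂ • x - ExteriorAlgebra.ι ℂ w * _)
    rw [map_sub, map_smul, map_mul, ExteriorAlgebra.map_apply_ι]

theorem inner_algebraMap_left (c : ℂ) (x : ExteriorAlgebra ℂ K) :
    ⟪algebraMap ℂ (ExteriorAlgebra ℂ K) c, x⟫_ℂ = conj c * ExteriorAlgebra.algebraMapInv x := by
  rw [← inner_conj_symm, show ⟪x, algebraMap ℂ _ c⟫_ℂ = _ from gramForm_algebraMap c x, map_mul,
    Complex.conj_conj]

theorem algebraMapInv_map (f : V →ₗ[ℂ] W) (x : ExteriorAlgebra ℂ V) :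
    ExteriorAlgebra.algebraMapInv (ExteriorAlgebra.map f x) = ExteriorAlgebra.algebraMapInv x := by
  have h : ExteriorAlgebra.algebraMapInv.comp (ExteriorAlgebra.map f)
      = ExteriorAlgebra.algebraMapInv := by
    ext v
    simp [ExteriorAlgebra.algebraMapInv]
  rw [← h, AlgHom.comp_apply]

theorem inner_map_map_congr {f : V →ₗ[ℂ] K} {g : W →ₗ[ℂ] K} {f' : V →ₗ[ℂ] K'} {g' : W →ₗ[ℂ] K'}
    (h : ∀ v w, ⟪f v, g w⟫_ℂ = ⟪f' v, g' w⟫_ℂ) (x : ExteriorAlgebra ℂ V)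
    (y : ExteriorAlgebra ℂ W) :
    ⟪ExteriorAlgebra.map f x, ExteriorAlgebra.map g y⟫_ℂ
      = ⟪ExteriorAlgebra.map f' x, ExteriorAlgebra.map g' y⟫_ℂ := by
  induction x using exteriorAlgebra_left_induction generalizing y with
  | algebraMap c => simp only [AlgHom.commutes, inner_algebraMap_left, algebraMapInv_map]
  | add x x' hx hx' => simp only [map_add, inner_add_left, hx, hx']
  | ι_mul x v hx =>
    have hv : innerₛₗ ℂ (f v) ∘ₗ g = innerₛₗ ℂ (f' v) ∘ₗ g' := LinearMap.ext (h v)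
    simp only [map_mul, ExteriorAlgebra.map_apply_ι, inner_ι_mul_left, annihAlg_map, hv, hx]

theorem norm_exteriorAlgebra_map (f : K →ₗᵢ[ℂ] K') (x : ExteriorAlgebra ℂ K) :
    ‖ExteriorAlgebra.map f.toLinearMap x‖ = ‖x‖ := by
  have h := inner_map_map_congr (f := f.toLinearMap) (g := f.toLinearMap) (f' := LinearMap.id)
    (g' := LinearMap.id) f.inner_map_map x x
  rw [ExteriorAlgebra.map_id, AlgHom.id_apply] at h
  rw [@norm_eq_sqrt_re_inner ℂ, h, ← @norm_eq_sqrt_re_inner ℂ]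

end Exterior

section CAR

variable {K : Type u} [NormedAddCommGroup K] [InnerProductSpace ℂ K]

theorem fock_ext {F : Type*} [TopologicalSpace F] [AddCommMonoid F] [Module ℂ F] [T2Space F]
    {A B : Fock K →L[ℂ] F} (h : ∀ x, A (toFock x) = B (toFock x)) : A = B :=
  ContinuousLinearMap.coeFn_injective
    (denseRange_toFock.equalizer A.continuous B.continuous (funext h))

theorem fock_ext_inner {y z : Fock K} (h : ∀ x, ⟪toFock x, y⟫_ℂ = ⟪toFock x, z⟫_ℂ) : y = z :=
  ext_inner_left ℂ (congrFun (denseRange_toFock.equalizer (by fun_prop) (by fun_prop) (funext h)))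

theorem annihilation_toFock (ψ : K) (x : ExteriorAlgebra ℂ K) :
    annihilation ψ (toFock x) = toFock (annihAlg ψ x) := by
  refine fock_ext_inner fun y => ?_
  rw [annihilation, ContinuousLinearMap.adjoint_inner_right, creation_toFock,
    LinearIsometry.inner_map_map, LinearIsometry.inner_map_map, inner_ι_mul_left]

theorem annihilation_vacuum (ψ : K) : annihilation ψ (vacuum K) = 0 := by
  rw [vacuum, annihilation_toFock, ← map_one (algebraMap ℂ (ExteriorAlgebra ℂ K)),
    annihAlg_algebraMap, map_zero]

theorem creation_add (ψ χ : K) : creation (ψ + χ) = creation ψ + creation χ :=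
  fock_ext fun x => by simp [creation_toFock, add_mul]

theorem creation_smul (c : ℂ) (ψ : K) : creation (c • ψ) = c • creation ψ :=
  fock_ext fun x => by simp [creation_toFock]

theorem norm_creation_le (ψ : K) : ‖creation ψ‖ ≤ ‖ψ‖ :=
  ContinuousLinearMap.opNorm_le_bound _ (norm_nonneg _) fun z => denseRange_toFock.induction_on
    (p := fun z => ‖creation ψ z‖ ≤ ‖ψ‖ * ‖z‖) z (isClosed_le (by fun_prop) (by fun_prop))
    fun x => by
      rw [creation_toFock, LinearIsometry.norm_map, LinearIsometry.norm_map]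
      exact norm_createAlg_le ψ x

/-- The creation operator as a continuous linear function of its argument. -/
def creationCLM : K →L[ℂ] Fock K →L[ℂ] Fock K :=
  LinearMap.mkContinuous ⟨⟨creation, creation_add⟩, creation_smul⟩ 1 fun ψ => by
    simpa using norm_creation_le ψ

theorem continuous_creation : Continuous (creation : K → Fock K →L[ℂ] Fock K) :=
  creationCLM.continuous

theorem annihilation_add (ψ χ : K) : annihilation (ψ + χ) = annihilation ψ + annihilation χ := by
  simp [annihilation, creation_add]

theorem annihilation_smul (c : ℂ) (ψ : K) : annihilation (c • ψ) = conj c • annihilation ψ := by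
  rw [annihilation, creation_smul, map_smulₛₗ]
  rfl

theorem norm_annihilation_le (ψ : K) : ‖annihilation ψ‖ ≤ ‖ψ‖ :=
  (LinearIsometryEquiv.norm_map _ _).trans_le (norm_creation_le ψ)

theorem annihilation_mul_creation_add (ψ χ : K) :
    annihilation ψ * creation χ + creation χ * annihilation ψ = ⟪ψ, χ⟫_ℂ • 1 :=
  fock_ext fun x => by
    simp [creation_toFock, annihilation_toFock, annihAlg_ι_mul]

theorem creation_mul_creation_add (ψ χ : K) :
    creation ψ * creation χ + creation χ * creation ψ = 0 :=
  fock_ext fun x => by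
    have h := ExteriorAlgebra.ι_add_mul_swap (R := ℂ) ψ χ
    simp [creation_toFock, ← map_add, ← mul_assoc, ← add_mul, h]

theorem annihilation_mul_annihilation_add (ψ χ : K) :
    annihilation ψ * annihilation χ + annihilation χ * annihilation ψ = 0 := by
  have h := congrArg star (creation_mul_creation_add ψ χ)
  simpa [annihilation, star_add, star_mul, ContinuousLinearMap.star_eq_adjoint, add_comm] using h

theorem creation_mul_field_add (η χ : K) :
    creation η * field χ + field χ * creation η = ⟪χ, η⟫_ℂ • 1 := by
  calc _ = (creation η * creation χ + creation χ * creation η)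
        + (annihilation χ * creation η + creation η * annihilation χ) := by
        rw [field]; noncomm_ring
    _ = _ := by rw [creation_mul_creation_add, annihilation_mul_creation_add, zero_add]

theorem annihilation_mul_field_add (θ χ : K) :
    annihilation θ * field χ + field χ * annihilation θ = ⟪θ, χ⟫_ℂ • 1 := by
  calc _ = (annihilation θ * annihilation χ + annihilation χ * annihilation θ)
        + (annihilation θ * creation χ + creation χ * annihilation θ) := by
        rw [field]; noncomm_ring
    _ = _ := by rw [annihilation_mul_annihilation_add, annihilation_mul_creation_add, zero_add]

end CAR

section FockMap

variable {K K' : Type*} [NormedAddCommGroup K] [InnerProductSpace ℂ K]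
  [NormedAddCommGroup K'] [InnerProductSpace ℂ K']

/-- The second quantization `⊕ₙ f^{⊗n}` of an isometry `f` as a bounded operator. -/
def fockMap (f : K →ₗᵢ[ℂ] K') : Fock K →L[ℂ] Fock K' :=
  (toFock.toLinearMap ∘ₗ (ExteriorAlgebra.map f.toLinearMap).toLinearMap).extendOfNorm
    toFock.toLinearMap

theorem norm_toFock_map (f : K →ₗᵢ[ℂ] K') (x : ExteriorAlgebra ℂ K) :
    ‖toFock (ExteriorAlgebra.map f.toLinearMap x)‖ = ‖toFock x‖ := by
  rw [LinearIsometry.norm_map, LinearIsometry.norm_map, norm_exteriorAlgebra_map]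

theorem fockMap_toFock (f : K →ₗᵢ[ℂ] K') (x : ExteriorAlgebra ℂ K) :
    fockMap f (toFock x) = toFock (ExteriorAlgebra.map f.toLinearMap x) :=
  LinearMap.extendOfNorm_eq (e := toFock.toLinearMap) denseRange_toFock
    ⟨1, fun x => (norm_toFock_map f x).le.trans_eq (one_mul _).symm⟩ x

theorem norm_fockMap_le (f : K →ₗᵢ[ℂ] K') : ‖fockMap f‖ ≤ 1 :=
  LinearMap.opNorm_extendOfNorm_le denseRange_toFock zero_le_one fun x =>
    (norm_toFock_map f x).le.trans_eq (one_mul _).symm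

theorem fockMap_comp_creation (f : K →ₗᵢ[ℂ] K') (ψ : K) :
    fockMap f ∘L creation ψ = creation (f ψ) ∘L fockMap f :=
  fock_ext fun x => by simp [fockMap_toFock, creation_toFock]

theorem fockMap_comp_annihilation (f : K →ₗᵢ[ℂ] K') (ψ : K) :
    fockMap f ∘L annihilation ψ = annihilation (f ψ) ∘L fockMap f :=
  fock_ext fun x => by
    have h : innerₛₗ ℂ (f ψ) ∘ₗ f.toLinearMap = innerₛₗ ℂ ψ := LinearMap.ext (f.inner_map_map ψ)
    simp only [ContinuousLinearMap.comp_apply, annihilation_toFock, fockMap_toFock, annihAlg_map, h]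
    rfl

/-- The parity operator `(-1)^N` on Fock space. -/
def parity : Fock K →L[ℂ] Fock K :=
  fockMap (LinearIsometryEquiv.neg ℂ (E := K)).toLinearIsometry

theorem norm_parity_le : ‖(parity : Fock K →L[ℂ] Fock K)‖ ≤ 1 := norm_fockMap_le _

theorem parity_mul_parity : (parity : Fock K →L[ℂ] Fock K) * parity = 1 :=
  fock_ext fun x => by
    rw [mul_apply_eq_comp, parity, fockMap_toFock, fockMap_toFock,
      ← AlgHom.comp_apply, ExteriorAlgebra.map_comp_map]
    have h : (LinearIsometryEquiv.neg ℂ (E := K)).toLinearIsometry.toLinearMap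
        ∘ₗ (LinearIsometryEquiv.neg ℂ (E := K)).toLinearIsometry.toLinearMap = LinearMap.id :=
      LinearMap.ext neg_neg
    rw [h, ExteriorAlgebra.map_id]
    rfl

theorem parity_mul_creation (ψ : K) : parity * creation ψ = -(creation ψ * parity) := by
  have h : creation (-ψ) = -creation ψ := by simpa using creation_smul (-1) ψ
  exact (fockMap_comp_creation _ ψ).trans
    ((congrArg (· ∘L parity) h).trans (ContinuousLinearMap.neg_comp _ _))

theorem parity_mul_annihilation (ψ : K) : parity * annihilation ψ = -(annihilation ψ * parity) := by
  have h : annihilation (-ψ) = -annihilation ψ := by simpa using annihilation_smul (-1) ψ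
  exact (fockMap_comp_annihilation _ ψ).trans
    ((congrArg (· ∘L parity) h).trans (ContinuousLinearMap.neg_comp _ _))

theorem parity_mul_field (ψ : K) : parity * field ψ = -(field ψ * parity) := by
  rw [field, mul_add, parity_mul_creation, parity_mul_annihilation, add_mul, neg_add]

end FockMap

section FieldAlgebra

variable {K : Type u} [NormedAddCommGroup K] [InnerProductSpace ℂ K] {L : Submodule ℝ K}

theorem mem_fieldAlgebra_iff {A : Fock K →L[ℂ] Fock K} :
    A ∈ fieldAlgebra L ↔ ∀ B, (∀ ψ ∈ L, Commute (field ψ) B) → Commute B A := by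
  rw [← SetLike.mem_coe, coe_fieldAlgebra]
  simp [Set.mem_centralizer_iff, Commute, SemiconjBy]

theorem field_mem_fieldAlgebra {ψ : K} (hψ : ψ ∈ L) : field ψ ∈ fieldAlgebra L :=
  mem_fieldAlgebra_iff.2 fun _ hB => (hB ψ hψ).symm

theorem smul_mem_fieldAlgebra (c : ℂ) {A : Fock K →L[ℂ] Fock K} (hA : A ∈ fieldAlgebra L) :
    c • A ∈ fieldAlgebra L :=
  (fieldAlgebra L).toStarSubalgebra.smul_mem hA c

theorem parity_conj_mem_fieldAlgebra {A : Fock K →L[ℂ] Fock K} (hA : A ∈ fieldAlgebra L) :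
    parity * A * parity ∈ fieldAlgebra L := by
  refine mem_fieldAlgebra_iff.2 fun B hB => ?_
  have hP := parity_mul_parity (K := K)
  have hPBP : Commute (parity * B * parity) A := mem_fieldAlgebra_iff.1 hA _ fun ψ hψ => by
    have hfP : field ψ * parity = -(parity * field ψ) := by rw [parity_mul_field, neg_neg]
    calc field ψ * (parity * B * parity) = (field ψ * parity) * B * parity := by noncomm_ring
      _ = -(parity * (field ψ * B) * parity) := by rw [hfP]; noncomm_ring
      _ = -(parity * B * (field ψ * parity)) := by rw [hB ψ hψ]; noncomm_ring
      _ = parity * B * parity * field ψ := by rw [hfP]; noncomm_ring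
  calc B * (parity * A * parity)
      = (parity * parity) * B * (parity * A * parity) := by rw [hP, one_mul]
    _ = parity * (parity * B * parity * A) * parity := by noncomm_ring
    _ = (parity * A * parity) * B * (parity * parity) := by rw [hPBP]; noncomm_ring
    _ = parity * A * parity * B := by rw [hP, mul_one]

-- `C * parity` commutes with the generating fields, hence with the whole algebra.
theorem mul_eq_parity_conj_mul {C A : Fock K →L[ℂ] Fock K} (hA : A ∈ fieldAlgebra L)
    (hC : ∀ ψ ∈ L, C * field ψ + field ψ * C = 0) (hodd : parity * C = -(C * parity)) :
    C * A = parity * A * parity * C := by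
  have hCP : C * parity = -(parity * C) := by rw [hodd, neg_neg]
  have hcomm : Commute (C * parity) A := mem_fieldAlgebra_iff.1 hA _ fun ψ hψ => by
    calc field ψ * (C * parity) = -(C * field ψ) * parity := by
          rw [← mul_assoc, eq_neg_of_add_eq_zero_right (hC ψ hψ)]
      _ = C * parity * field ψ := by rw [mul_assoc C parity, parity_mul_field]; noncomm_ring
  calc C * A = (parity * parity) * C * A := by rw [parity_mul_parity, one_mul]
    _ = -(parity * (C * parity * A)) := by rw [hCP]; noncomm_ring
    _ = parity * A * parity * C := by rw [hcomm, hCP]; noncomm_ring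

theorem norm_parity_conj_le (A : Fock K →L[ℂ] Fock K) : ‖parity * A * parity‖ ≤ ‖A‖ :=
  calc ‖parity * A * parity‖ ≤ ‖parity‖ * ‖A‖ * ‖parity‖ := norm_mul₃_le
    _ ≤ 1 * ‖A‖ * 1 := by gcongr <;> exact norm_parity_le
    _ = ‖A‖ := by ring

end FieldAlgebra

section LocalAnnihilation

variable {K : Type u} [NormedAddCommGroup K] [InnerProductSpace ℂ K]

theorem IsAntilinearInvolution.norm_map {Γ : K →ₗ⋆[ℂ] K} (hΓ : IsAntilinearInvolution Γ) (ψ : K) :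
    ‖Γ ψ‖ = ‖ψ‖ := by
  rw [@norm_eq_sqrt_re_inner ℂ, @norm_eq_sqrt_re_inner ℂ _ _ _ _ ψ, hΓ.2, hΓ.1, RCLike.conj_re]

theorem field_add_I_smul_field (η θ : K) :
    field (θ + η) + Complex.I • field (Complex.I • θ - Complex.I • η)
      = (2 : ℂ) • (creation η + annihilation θ) := by
  rw [sub_eq_add_neg, ← neg_smul]
  simp only [field, creation_add, annihilation_add, creation_smul, annihilation_smul, smul_add,
    smul_smul, map_neg, Complex.conj_I, mul_neg, Complex.I_mul_I]
  module

theorem creation_add_annihilation_mem_fieldAlgebra (Γ : K →ₗ⋆[ℂ] K) {Lφ Lπ : Submodule ℂ K}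
    {u v : K} (hu : u ∈ Lφ) (hv : v ∈ Lπ) :
    creation (Γ (u - v)) + annihilation (u + v) ∈ fieldAlgebra (realSubspace Γ Lφ Lπ) := by
  have h₁ : (u + v) + Γ (u - v) ∈ realSubspace Γ Lφ Lπ :=
    ⟨u, hu, v, hv, by rw [map_sub]; abel⟩
  have h₂ : Complex.I • (u + v) - Complex.I • Γ (u - v) ∈ realSubspace Γ Lφ Lπ :=
    ⟨Complex.I • u, Lφ.smul_mem _ hu, Complex.I • v, Lπ.smul_mem _ hv, by
      simp only [map_sub, LinearMap.map_smulₛₗ, Complex.conj_I]; module⟩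
  have h : (2⁻¹ : ℂ) • (field ((u + v) + Γ (u - v))
        + Complex.I • field (Complex.I • (u + v) - Complex.I • Γ (u - v)))
      = creation (Γ (u - v)) + annihilation (u + v) := by
    rw [field_add_I_smul_field, inv_smul_smul₀ two_ne_zero]
  rw [← h]
  exact smul_mem_fieldAlgebra _ (add_mem (field_mem_fieldAlgebra h₁)
    (smul_mem_fieldAlgebra _ (field_mem_fieldAlgebra h₂)))

variable {Γ : K →ₗ⋆[ℂ] K} {Lφ Lπ : Submodule ℂ K} [Lφ.HasOrthogonalProjection]
  [Lπ.HasOrthogonalProjection]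

theorem IsAntilinearInvolution.inner_add_inner_starProjection (hΓ : IsAntilinearInvolution Γ)
    (hLφ : ∀ ψ ∈ Lφ, Γ ψ ∈ Lφ) (hLπ : ∀ ψ ∈ Lπ, Γ ψ ∈ Lπ) (ψ : K) {χ : K}
    (hχ : χ ∈ realSubspace Γ Lφ Lπ) :
    ⟪χ, Γ (Lφ.starProjection ψ - Lπ.starProjection ψ)⟫_ℂ
      + ⟪Lφ.starProjection ψ + Lπ.starProjection ψ, χ⟫_ℂ = 2 * ⟪ψ, χ⟫_ℂ := by
  obtain ⟨f, hf, g, hg, rfl⟩ := hχ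
  have hφ : ⟪Lφ.starProjection ψ, f + Γ f⟫_ℂ = ⟪ψ, f + Γ f⟫_ℂ := by
    rw [Submodule.inner_starProjection_left_eq_right,
      Submodule.starProjection_eq_self_iff.2 (Lφ.add_mem hf (hLφ f hf))]
  have hπ : ⟪Lπ.starProjection ψ, g - Γ g⟫_ℂ = ⟪ψ, g - Γ g⟫_ℂ := by
    rw [Submodule.inner_starProjection_left_eq_right,
      Submodule.starProjection_eq_self_iff.2 (Lπ.sub_mem hg (hLπ g hg))]
  have hΓχ : Γ (f + Γ f + (g - Γ g)) = f + Γ f - (g - Γ g) := by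
    simp only [map_add, map_sub, hΓ.1]
    abel
  rw [← inner_conj_symm, hΓ.2, Complex.conj_conj, hΓχ]
  simp only [inner_add_left, inner_sub_left, inner_add_right _ (f + Γ f),
    inner_sub_right _ (f + Γ f), hφ, hπ]
  ring

variable (Γ Lφ Lπ) in
/-- The element of the field algebra over `(1 + Γ) Lφ + (1 - Γ) Lπ` whose anticommutators with the
generating fields are those of the annihilation operator `a(ψ)`. -/
def localAnnihilation (ψ : K) : Fock K →L[ℂ] Fock K :=
  (2⁻¹ : ℂ) • (creation (Γ (Lφ.starProjection ψ - Lπ.starProjection ψ))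
    + annihilation (Lφ.starProjection ψ + Lπ.starProjection ψ))

/-- `‖u - v‖ + ‖u + v‖`. With `u = Eφ ψ`, `v = Eπ ψ` it measures the norm of the local annihilation
operator at `ψ`. -/
def sumDiffNorm (u v : K) : ℝ := ‖u - v‖ + ‖u + v‖

theorem localAnnihilation_mem (ψ : K) :
    localAnnihilation Γ Lφ Lπ ψ ∈ fieldAlgebra (realSubspace Γ Lφ Lπ) :=
  smul_mem_fieldAlgebra _ (creation_add_annihilation_mem_fieldAlgebra Γ
    (Lφ.starProjection_apply_mem ψ) (Lπ.starProjection_apply_mem ψ))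

theorem IsAntilinearInvolution.two_mul_norm_localAnnihilation_le (hΓ : IsAntilinearInvolution Γ)
    (ψ : K) : 2 * ‖localAnnihilation Γ Lφ Lπ ψ‖
      ≤ sumDiffNorm (Lφ.starProjection ψ) (Lπ.starProjection ψ) := by
  rw [localAnnihilation, norm_smul, norm_inv, RCLike.norm_ofNat, mul_inv_cancel_left₀ two_ne_zero]
  exact (norm_add_le _ _).trans (add_le_add ((norm_creation_le _).trans_eq (hΓ.norm_map _))
    (norm_annihilation_le _))

theorem IsAntilinearInvolution.localAnnihilation_mul_field_add (hΓ : IsAntilinearInvolution Γ)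
    (hLφ : ∀ ψ ∈ Lφ, Γ ψ ∈ Lφ) (hLπ : ∀ ψ ∈ Lπ, Γ ψ ∈ Lπ) (ψ : K) {χ : K}
    (hχ : χ ∈ realSubspace Γ Lφ Lπ) :
    localAnnihilation Γ Lφ Lπ ψ * field χ + field χ * localAnnihilation Γ Lφ Lπ ψ
      = ⟪ψ, χ⟫_ℂ • 1 := by
  rw [localAnnihilation, smul_mul_assoc, mul_smul_comm, ← smul_add, add_mul, mul_add,
    add_add_add_comm, creation_mul_field_add, annihilation_mul_field_add, ← add_smul,
    hΓ.inner_add_inner_starProjection hLφ hLπ ψ hχ, smul_smul, inv_mul_cancel_left₀ two_ne_zero]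

theorem parity_mul_localAnnihilation (ψ : K) :
    parity * localAnnihilation Γ Lφ Lπ ψ = -(localAnnihilation Γ Lφ Lπ ψ * parity) := by
  rw [localAnnihilation, mul_smul_comm, smul_mul_assoc, mul_add, add_mul, parity_mul_creation,
    parity_mul_annihilation, ← neg_add, smul_neg]

-- `a(ψ)` minus its local version has vanishing graded commutator with the field algebra, so on
-- `A Ω` it may be moved past `A`, where `a(ψ) Ω = 0` leaves local operators only.
theorem IsAntilinearInvolution.exists_annihilation_eq (hΓ : IsAntilinearInvolution Γ)
    (hLφ : ∀ ψ ∈ Lφ, Γ ψ ∈ Lφ) (hLπ : ∀ ψ ∈ Lπ, Γ ψ ∈ Lπ) (ψ : K) {A : Fock K →L[ℂ] Fock K}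
    (hA : A ∈ fieldAlgebra (realSubspace Γ Lφ Lπ)) :
    ∃ B ∈ fieldAlgebra (realSubspace Γ Lφ Lπ), annihilation ψ (A (vacuum K)) = B (vacuum K) ∧
      ‖B‖ ≤ sumDiffNorm (Lφ.starProjection ψ) (Lπ.starProjection ψ) * ‖A‖ := by
  set b := localAnnihilation Γ Lφ Lπ ψ
  set A' := parity * A * parity
  have hcomm : (annihilation ψ - b) * A = A' * (annihilation ψ - b) := by
    refine mul_eq_parity_conj_mul hA (fun χ hχ => ?_) ?_
    · rw [sub_mul, mul_sub, sub_add_sub_comm, annihilation_mul_field_add,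
        hΓ.localAnnihilation_mul_field_add hLφ hLπ ψ hχ, sub_self]
    · rw [mul_sub, sub_mul, parity_mul_annihilation, parity_mul_localAnnihilation, neg_sub_neg,
        neg_sub]
  refine ⟨b * A - A' * b, sub_mem (mul_mem (localAnnihilation_mem ψ) hA)
    (mul_mem (parity_conj_mem_fieldAlgebra hA) (localAnnihilation_mem ψ)), ?_, ?_⟩
  · have hΩ := DFunLike.congr_fun hcomm (vacuum K)
    simp only [mul_apply_eq_comp, sub_apply, annihilation_vacuum, zero_sub, map_neg] at hΩ ⊢
    rw [sub_eq_iff_eq_add.1 hΩ]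
    abel
  · calc ‖b * A - A' * b‖ ≤ ‖b‖ * ‖A‖ + ‖A'‖ * ‖b‖ :=
          (norm_sub_le _ _).trans (add_le_add (norm_mul_le _ _) (norm_mul_le _ _))
      _ ≤ ‖b‖ * ‖A‖ + ‖A‖ * ‖b‖ := by gcongr; exact norm_parity_conj_le A
      _ = 2 * ‖b‖ * ‖A‖ := by ring
      _ ≤ _ := by gcongr; exact hΓ.two_mul_norm_localAnnihilation_le ψ

end LocalAnnihilation

section SecondQuantization

variable {K : Type u} [NormedAddCommGroup K] [InnerProductSpace ℂ K]

theorem denseRange_toFock_map_subtype {V : Submodule ℂ K} (hV : Dense (V : Set K)) :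
    DenseRange fun w : ExteriorAlgebra ℂ V => toFock (ExteriorAlgebra.map V.subtype w) :=
  denseRange_toFock.comp (dense_map_domain hV) toFock.continuous

variable {X Y : K →ₗ.[ℂ] K}

theorem inner_snd_eq_inner_fst_of_mem_closure (hYX : Y.IsFormalAdjoint X) {p : Fock K × Fock K}
    (hp : p ∈ (secondQuantizationGraph X).topologicalClosure) (w : ExteriorAlgebra ℂ Y.domain) :
    ⟪toFock (ExteriorAlgebra.map Y.domain.subtype w), p.2⟫_ℂ
      = ⟪toFock (ExteriorAlgebra.map Y.toFun w), p.1⟫_ℂ := by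
  refine closure_minimal (t := {p : Fock K × Fock K | ⟪toFock _, p.2⟫_ℂ = ⟪toFock _, p.1⟫_ℂ})
    ?_ (isClosed_eq (by fun_prop) (by fun_prop)) hp
  rintro _ ⟨z, rfl⟩
  change ⟪toFock _, toFock (ExteriorAlgebra.map X.toFun z)⟫_ℂ
    = ⟪toFock _, toFock (ExteriorAlgebra.map X.domain.subtype z)⟫_ℂ
  rw [LinearIsometry.inner_map_map, LinearIsometry.inner_map_map]
  exact inner_map_map_congr (fun v u => (hYX v u).symm) w z

theorem graph_secondQuantization_of_isFormalAdjoint (hYX : Y.IsFormalAdjoint X)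
    (hY : Dense (Y.domain : Set K)) :
    (secondQuantization X).graph = (secondQuantizationGraph X).topologicalClosure := by
  refine Submodule.toLinearPMap_graph_eq _ fun p hp hp₁ => ext_inner_left ℂ ?_
  refine congrFun ((denseRange_toFock_map_subtype hY).equalizer (by fun_prop) (by fun_prop)
    (funext fun w => ?_))
  simp only [Function.comp_apply, inner_snd_eq_inner_fst_of_mem_closure hYX hp, hp₁,
    inner_zero_right]

theorem inner_toFock_map_secondQuantization (hYX : Y.IsFormalAdjoint X)
    (hY : Dense (Y.domain : Set K)) (w : ExteriorAlgebra ℂ Y.domain)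
    (y : (secondQuantization X).domain) :
    ⟪toFock (ExteriorAlgebra.map Y.domain.subtype w), secondQuantization X y⟫_ℂ
      = ⟪toFock (ExteriorAlgebra.map Y.toFun w), (y : Fock K)⟫_ℂ :=
  inner_snd_eq_inner_fst_of_mem_closure hYX
    (graph_secondQuantization_of_isFormalAdjoint hYX hY ▸ (secondQuantization X).mem_graph y) w

end SecondQuantization

section Wedge

variable {K : Type u} [NormedAddCommGroup K] [InnerProductSpace ℂ K]

/-- The vector `ψ₁ ∧ ⋯ ∧ ψₙ` of Fock space. -/
def wedge (l : List K) : Fock K := toFock (l.map (ExteriorAlgebra.ι ℂ)).prod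

theorem wedge_nil : wedge ([] : List K) = vacuum K := rfl

theorem wedge_cons (ψ : K) (l : List K) : wedge (ψ :: l) = creation ψ (wedge l) := by
  simp [wedge, creation_toFock]

theorem wedge_map {V : Type*} [AddCommGroup V] [Module ℂ V] (f : V →ₗ[ℂ] K) (l : List V) :
    wedge (l.map f) = toFock (ExteriorAlgebra.map f (l.map (ExteriorAlgebra.ι ℂ)).prod) := by
  simp [wedge, map_list_prod, Function.comp_def]

theorem norm_vacuum : ‖vacuum K‖ = 1 := by
  have h : ⟪(1 : ExteriorAlgebra ℂ K), 1⟫_ℂ = 1 := by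
    simpa using inner_algebraMap_left 1 (1 : ExteriorAlgebra ℂ K)
  rw [vacuum, LinearIsometry.norm_map, @norm_eq_sqrt_re_inner ℂ, h, RCLike.one_re, Real.sqrt_one]

theorem continuous_wedge_ofFn (n : ℕ) :
    Continuous fun ξ : Fin n → K => wedge (List.ofFn ξ) := by
  induction n with
  | zero => simpa using continuous_const
  | succ n ih =>
    simp only [List.ofFn_succ, wedge_cons]
    exact (continuous_creation.comp (continuous_apply 0)).clm_apply
      (ih.comp (continuous_pi fun i => continuous_apply i.succ))

theorem inner_wedge_secondQuantization {X Y : K →ₗ.[ℂ] K} (hYX : Y.IsFormalAdjoint X)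
    (hY : Dense (Y.domain : Set K)) (l : List Y.domain) (y : (secondQuantization X).domain) :
    ⟪wedge (l.map Y.domain.subtype), secondQuantization X y⟫_ℂ
      = ⟪wedge (l.map Y.toFun), (y : Fock K)⟫_ℂ := by
  rw [wedge_map, wedge_map, inner_toFock_map_secondQuantization hYX hY]

theorem norm_inner_wedge_le_of_dense {D : Submodule ℂ K} (hD : Dense (D : Set K)) {c : K → ℝ}
    (hc : Continuous c) {y : Fock K} {C : ℝ}
    (h : ∀ l : List D, ‖⟪wedge (l.map D.subtype), y⟫_ℂ‖ ≤ (l.map fun ξ : D => c ξ).prod * C)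
    (l : List K) : ‖⟪wedge l, y⟫_ℂ‖ ≤ (l.map c).prod * C := by
  suffices H : ∀ ξ : Fin l.length → K, ‖⟪wedge (List.ofFn ξ), y⟫_ℂ‖ ≤ (∏ i, c (ξ i)) * C by
    simpa [← List.prod_ofFn, ← Function.comp_def c, ← List.map_ofFn] using H l.get
  have hwedge := continuous_wedge_ofFn (K := K) l.length
  have hclosed : IsClosed {ξ : Fin l.length → K |
      ‖⟪wedge (List.ofFn ξ), y⟫_ℂ‖ ≤ (∏ i, c (ξ i)) * C} :=
    isClosed_le (by fun_prop) (by fun_prop)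
  have hdense : Dense (Set.univ.pi fun _ : Fin l.length => (D : Set K)) :=
    dense_pi _ fun _ _ => hD
  refine fun ξ => closure_minimal (fun ξ hξ => ?_) hclosed (hdense ξ)
  have hξD := h (List.ofFn fun i => ⟨ξ i, hξ i trivial⟩)
  simpa only [List.map_ofFn, List.prod_ofFn, Function.comp_def, Submodule.subtype_apply,
    Set.mem_ofPred_eq] using hξD

theorem norm_inner_wedge_le {𝒜 : Set (Fock K →L[ℂ] Fock K)} {c : K → ℝ} (hc : ∀ ψ, 0 ≤ c ψ)
    (h𝒜 : ∀ ψ, ∀ A ∈ 𝒜, ∃ B ∈ 𝒜,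
      annihilation ψ (A (vacuum K)) = B (vacuum K) ∧ ‖B‖ ≤ c ψ * ‖A‖)
    (l : List K) {A : Fock K →L[ℂ] Fock K} (hA : A ∈ 𝒜) :
    ‖⟪wedge l, A (vacuum K)⟫_ℂ‖ ≤ (l.map c).prod * ‖A‖ := by
  induction l generalizing A with
  | nil =>
    calc ‖⟪vacuum K, A (vacuum K)⟫_ℂ‖ ≤ ‖vacuum K‖ * (‖A‖ * ‖vacuum K‖) :=
          (norm_inner_le_norm _ _).trans (by gcongr; exact A.le_opNorm _)
      _ = 1 * ‖A‖ := by rw [norm_vacuum, mul_one]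
  | cons ψ l ih =>
    obtain ⟨B, hB, hAB, hBA⟩ := h𝒜 ψ A hA
    have hl : 0 ≤ (l.map c).prod := List.prod_nonneg (by simpa using fun ψ _ => hc ψ)
    rw [wedge_cons, ← ContinuousLinearMap.adjoint_inner_right, ← annihilation, hAB]
    calc ‖⟪wedge l, B (vacuum K)⟫_ℂ‖ ≤ (l.map c).prod * (c ψ * ‖A‖) :=
          (ih hB).trans (by gcongr)
      _ = ((ψ :: l).map c).prod * ‖A‖ := by rw [List.map_cons, List.prod_cons]; ring

end Wedge

section CoefficientBound

theorem sumDiffNorm_nonneg {K : Type*} [NormedAddCommGroup K] (u v : K) : 0 ≤ sumDiffNorm u v :=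
  add_nonneg (norm_nonneg _) (norm_nonneg _)

variable {K : Type u} [NormedAddCommGroup K] [InnerProductSpace ℂ K]

-- The adjoint moves the second quantization onto the wedge product, where it acts factorwise.
theorem norm_inner_wedge_nuclearityMap_le {Γ : K →ₗ⋆[ℂ] K} (hΓ : IsAntilinearInvolution Γ)
    {Lφ Lπ : Submodule ℂ K} [Lφ.HasOrthogonalProjection] [Lπ.HasOrthogonalProjection]
    (hLφ : ∀ ψ ∈ Lφ, Γ ψ ∈ Lφ) (hLπ : ∀ ψ ∈ Lπ, Γ ψ ∈ Lπ)
    {X Y : K →ₗ.[ℂ] K} (hYX : Y.IsFormalAdjoint X) (hY : Dense (Y.domain : Set K))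
    (hdom : ∀ A ∈ fieldAlgebra (realSubspace Γ Lφ Lπ),
      A (vacuum K) ∈ (secondQuantization X).domain)
    {Tφ Tπ : K →L[ℂ] K} (hTφ : ∀ ψ : Y.domain, Tφ ψ = Lφ.starProjection (Y ψ))
    (hTπ : ∀ ψ : Y.domain, Tπ ψ = Lπ.starProjection (Y ψ))
    (A : (fieldAlgebra (realSubspace Γ Lφ Lπ)).toStarSubalgebra) (l : List K) :
    ‖⟪wedge l, nuclearityMap X _ hdom A⟫_ℂ‖
      ≤ (l.map fun ξ => sumDiffNorm (Tφ ξ) (Tπ ξ)).prod * ‖A‖ := by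
  refine norm_inner_wedge_le_of_dense hY (by unfold sumDiffNorm; fun_prop) (fun l => ?_) l
  have hl : (l.map fun ξ : Y.domain => sumDiffNorm (Tφ ξ) (Tπ ξ))
      = (l.map Y.toFun).map fun ψ => sumDiffNorm (Lφ.starProjection ψ) (Lπ.starProjection ψ) := by
    simp only [List.map_map, Function.comp_def, hTφ, hTπ, LinearPMap.toFun_eq_coe]
  change ‖⟪_, secondQuantization X _⟫_ℂ‖ ≤ _
  rw [hl, inner_wedge_secondQuantization hYX hY]
  exact norm_inner_wedge_le (fun ψ => sumDiffNorm_nonneg _ _)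
    (fun ψ A hA => hΓ.exists_annihilation_eq hLφ hLπ ψ hA) _ A.2

end CoefficientBound

section HilbertSchmidt

open scoped ENNReal

variable {H H' : Type*} [NormedAddCommGroup H] [InnerProductSpace ℂ H]
  [NormedAddCommGroup H'] [InnerProductSpace ℂ H']

theorem tsum_enorm_inner_sq {ι : Type*} (b : HilbertBasis ι ℂ H) (x : H) :
    ∑' i, ‖⟪b i, x⟫_ℂ‖ₑ ^ 2 = ‖x‖ₑ ^ 2 := by
  have h := lp.hasSum_norm (p := 2) (by norm_num) (b.repr x)
  simp only [ENNReal.toReal_ofNat, Real.rpow_ofNat, b.repr.norm_map, b.repr_apply_apply] at h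
  simpa [ENNReal.ofReal_pow, ofReal_norm, h.tsum_eq] using
    (ENNReal.ofReal_tsum_of_nonneg (fun i => sq_nonneg ‖⟪b i, x⟫_ℂ‖) h.summable).symm

/-- The finite rank operator that agrees with `S` on the basis vectors `b i`, `i ∈ s`, and vanishes
on the others. -/
def truncation {ι : Type*} (b : HilbertBasis ι ℂ H) (S : H →L[ℂ] H') (s : Finset ι) : H →L[ℂ] H' :=
  ∑ i ∈ s, (innerSL ℂ (b i)).smulRight (S (b i))

theorem truncation_apply_basis {ι : Type*} [DecidableEq ι] (b : HilbertBasis ι ℂ H)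
    (S : H →L[ℂ] H') (s : Finset ι) (i : ι) :
    truncation b S s (b i) = if i ∈ s then S (b i) else 0 := by
  simp [truncation, orthonormal_iff_ite.1 b.orthonormal]

theorem isCompactOperator_truncation {ι : Type*} (b : HilbertBasis ι ℂ H) (S : H →L[ℂ] H')
    (s : Finset ι) : IsCompactOperator (truncation b S s) :=
  (compactOperator (RingHom.id ℂ) H H').sum_mem fun i _ =>
    (isCompactOperator_of_locallyCompactSpace_rng
      (ContinuousLinearMap.toSpanSingleton ℂ (S (b i)))).comp_clm (innerSL ℂ (b i))

variable [CompleteSpace H]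

/-- The squared Hilbert–Schmidt norm of `S` with values in `[0, ∞]`, finite precisely on the
Hilbert–Schmidt operators. -/
def hsNormSq (S : H →L[ℂ] H') : ℝ≥0∞ := ∑' i, ‖S (onBasis H i)‖ₑ ^ 2

variable [CompleteSpace H']

theorem tsum_enorm_sq_eq_tsum_enorm_adjoint_sq {ι κ : Type*} (b : HilbertBasis ι ℂ H)
    (c : HilbertBasis κ ℂ H') (S : H →L[ℂ] H') :
    ∑' i, ‖S (b i)‖ₑ ^ 2 = ∑' j, ‖S.adjoint (c j)‖ₑ ^ 2 := by
  calc ∑' i, ‖S (b i)‖ₑ ^ 2 = ∑' i, ∑' j, ‖⟪c j, S (b i)⟫_ℂ‖ₑ ^ 2 := by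
        simp only [tsum_enorm_inner_sq c]
    _ = ∑' j, ∑' i, ‖⟪c j, S (b i)⟫_ℂ‖ₑ ^ 2 := ENNReal.tsum_comm
    _ = ∑' j, ∑' i, ‖⟪b i, S.adjoint (c j)⟫_ℂ‖ₑ ^ 2 := by
        refine tsum_congr fun j => tsum_congr fun i => ?_
        rw [ContinuousLinearMap.adjoint_inner_right, ← ofReal_norm, norm_inner_symm, ofReal_norm]
    _ = ∑' j, ‖S.adjoint (c j)‖ₑ ^ 2 := by simp only [tsum_enorm_inner_sq b]

theorem hsNormSq_adjoint (S : H →L[ℂ] H') : hsNormSq S.adjoint = hsNormSq S :=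
  (tsum_enorm_sq_eq_tsum_enorm_adjoint_sq _ _ S).symm

theorem hsNormSq_eq_tsum {ι : Type*} (b : HilbertBasis ι ℂ H) (S : H →L[ℂ] H') :
    hsNormSq S = ∑' i, ‖S (b i)‖ₑ ^ 2 := by
  rw [← hsNormSq_adjoint, hsNormSq, tsum_enorm_sq_eq_tsum_enorm_adjoint_sq b (onBasis H')]

theorem hsNormSq_comp_le_of_norm_le_one {G : Type*} [NormedAddCommGroup G]
    [InnerProductSpace ℂ G] [CompleteSpace G] (S : H →L[ℂ] H') (C : G →L[ℂ] H) (hC : ‖C‖ ≤ 1) :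
    hsNormSq (S ∘L C) ≤ hsNormSq S := by
  rw [← hsNormSq_adjoint, ContinuousLinearMap.adjoint_comp, ← hsNormSq_adjoint S]
  have hC' : ‖C.adjoint‖ ≤ 1 := by rwa [LinearIsometryEquiv.norm_map]
  refine ENNReal.tsum_le_tsum fun i => ?_
  gcongr
  exact enorm_le_iff_norm_le.2 (C.adjoint.le_of_opNorm_le hC' _ |>.trans_eq (one_mul _))

theorem enorm_apply_sq_le_hsNormSq_mul (S : H →L[ℂ] H') (x : H) :
    ‖S x‖ₑ ^ 2 ≤ hsNormSq S * ‖x‖ₑ ^ 2 := by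
  rw [← hsNormSq_adjoint, hsNormSq, ← tsum_enorm_inner_sq (onBasis H'), ← ENNReal.tsum_mul_right]
  refine ENNReal.tsum_le_tsum fun i => ?_
  rw [← ContinuousLinearMap.adjoint_inner_left, ← mul_pow]
  gcongr
  exact ENNReal.coe_le_coe.2 (nnnorm_inner_le_nnnorm ..)

theorem enorm_le_hsNormSq_rpow (S : H →L[ℂ] H') : ‖S‖ₑ ≤ hsNormSq S ^ (2⁻¹ : ℝ) := by
  refine S.opENorm_le_bound fun x => ?_
  rw [← ENNReal.rpow_le_rpow_iff (z := 2) (by norm_num),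
    ENNReal.mul_rpow_of_nonneg _ _ (by norm_num), ← ENNReal.rpow_mul]
  simpa using enorm_apply_sq_le_hsNormSq_mul S x

theorem hsNormSq_sub_truncation {ι : Type*} (b : HilbertBasis ι ℂ H) (S : H →L[ℂ] H')
    (s : Finset ι) : hsNormSq (S - truncation b S s) = ∑' i : {i // i ∉ s}, ‖S (b i)‖ₑ ^ 2 := by
  classical
  rw [hsNormSq_eq_tsum b]
  refine Eq.trans (tsum_congr fun i => ?_) (tsum_subtype {i | i ∉ s} fun i => ‖S (b i)‖ₑ ^ 2).symm
  by_cases hi : i ∈ s <;> simp [truncation_apply_basis, hi]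

theorem isCompactOperator_of_hsNormSq_ne_top {S : H →L[ℂ] H'} (hS : hsNormSq S ≠ ⊤) :
    IsCompactOperator S := by
  have hzero : Filter.Tendsto (fun s => hsNormSq (S - truncation (onBasis H) S s)) Filter.atTop
      (nhds 0) := by
    simp only [hsNormSq_sub_truncation]
    exact ENNReal.tendsto_tsum_compl_atTop_zero hS
  have hlim : Filter.Tendsto (truncation (onBasis H) S) Filter.atTop (nhds S) := by
    rw [tendsto_iff_edist_tendsto_0]
    refine tendsto_of_tendsto_of_tendsto_of_le_of_le tendsto_const_nhds
      (by simpa using hzero.ennrpow_const (2⁻¹ : ℝ)) (fun _ => zero_le) fun s => ?_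
    rw [edist_comm, edist_eq_enorm_sub]
    exact enorm_le_hsNormSq_rpow _
  exact isCompactOperator_of_tendsto hlim
    (Filter.Eventually.of_forall (isCompactOperator_truncation _ S))

end HilbertSchmidt

section Trace

open scoped ENNReal

variable {H : Type*} [NormedAddCommGroup H] [InnerProductSpace ℂ H] [CompleteSpace H]

/-- The trace of a positive operator, with values in `[0, ∞]`. For operators that are not positive
the negative diagonal matrix elements are replaced by zero. -/
def posTrace (A : H →L[ℂ] H) : ℝ≥0∞ :=
  ∑' i, ENNReal.ofReal (⟪onBasis H i, A (onBasis H i)⟫_ℂ).re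

theorem inner_apply_eq_inner_sqrt_apply {A : H →L[ℂ] H} (hA : 0 ≤ A) (x y : H) :
    ⟪x, A y⟫_ℂ = ⟪CFC.sqrt A x, CFC.sqrt A y⟫_ℂ := by
  have hsa : IsSelfAdjoint (CFC.sqrt A) := (CFC.sqrt_nonneg A).isSelfAdjoint
  rw [← ContinuousLinearMap.adjoint_inner_right, hsa.adjoint_eq, ← mul_apply_eq_comp,
    CFC.sqrt_mul_sqrt_self A hA]

theorem ofReal_re_inner_apply_self {A : H →L[ℂ] H} (hA : 0 ≤ A) (x : H) :
    ENNReal.ofReal (⟪x, A x⟫_ℂ).re = ‖CFC.sqrt A x‖ₑ ^ 2 := by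
  have hre : (⟪x, A x⟫_ℂ).re = ‖CFC.sqrt A x‖ ^ 2 := by
    rw [inner_apply_eq_inner_sqrt_apply hA]
    exact inner_self_eq_norm_sq (𝕜 := ℂ) _
  rw [hre, ENNReal.ofReal_pow (norm_nonneg _), ofReal_norm]

theorem posTrace_eq_hsNormSq_sqrt {A : H →L[ℂ] H} (hA : 0 ≤ A) :
    posTrace A = hsNormSq (CFC.sqrt A) :=
  tsum_congr fun _ => ofReal_re_inner_apply_self hA _

theorem posTrace_eq_tsum {ι : Type*} (b : HilbertBasis ι ℂ H) {A : H →L[ℂ] H} (hA : 0 ≤ A) :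
    posTrace A = ∑' i, ENNReal.ofReal (⟪b i, A (b i)⟫_ℂ).re := by
  simp only [posTrace_eq_hsNormSq_sqrt hA, hsNormSq_eq_tsum b, ofReal_re_inner_apply_self hA]

theorem isCompactOperator_of_posTrace_ne_top {A : H →L[ℂ] H} (hA : 0 ≤ A)
    (htr : posTrace A ≠ ⊤) : IsCompactOperator A := by
  rw [posTrace_eq_hsNormSq_sqrt hA] at htr
  rw [← CFC.sqrt_mul_sqrt_self A hA]
  exact (isCompactOperator_of_hsNormSq_ne_top htr).clm_comp (CFC.sqrt A)

theorem re_inner_apply_self_nonneg {A : H →L[ℂ] H} (hA : 0 ≤ A) (x : H) :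
    0 ≤ (⟪x, A x⟫_ℂ).re := by
  rw [inner_apply_eq_inner_sqrt_apply hA]
  exact inner_self_nonneg (𝕜 := ℂ)

theorem isTraceClass_iff_posTrace_ne_top {T : H →L[ℂ] H} :
    IsTraceClass T ↔ posTrace (CFC.abs T) ≠ ⊤ := by
  refine ⟨fun h => h.tsum_ofReal_ne_top, fun h => (ENNReal.summable_toReal h).congr fun i => ?_⟩
  rw [ENNReal.toReal_ofReal (re_inner_apply_self_nonneg (CFC.abs_nonneg T) _)]

theorem traceNorm_eq_toReal_posTrace (T : H →L[ℂ] H) :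
    traceNorm T = (posTrace (CFC.abs T)).toReal := by
  rw [posTrace, ENNReal.tsum_toReal_eq fun _ => ENNReal.ofReal_ne_top]
  simp only [ENNReal.toReal_ofReal (re_inner_apply_self_nonneg (CFC.abs_nonneg T) _), traceNorm]

theorem tsum_enorm_inner_le_posTrace {A C : H →L[ℂ] H} (hA : 0 ≤ A) (hC : ‖C‖ ≤ 1) :
    ∑' i, ‖⟪C (onBasis H i), A (onBasis H i)⟫_ℂ‖ₑ ≤ posTrace A := by
  set R := CFC.sqrt A
  have hamgm : ∀ x, 2 * ‖⟪C x, A x⟫_ℂ‖ₑ ≤ ‖(R ∘L C) x‖ₑ ^ 2 + ‖R x‖ₑ ^ 2 := fun x => by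
    rw [inner_apply_eq_inner_sqrt_apply hA]
    have hreal : 2 * ‖⟪R (C x), R x⟫_ℂ‖₊ ≤ ‖R (C x)‖₊ ^ 2 + ‖R x‖₊ ^ 2 :=
      (mul_le_mul_right (nnnorm_inner_le_nnnorm (𝕜 := ℂ) _ _) 2).trans
        ((mul_assoc ..).symm.trans_le (two_mul_le_add_sq _ _))
    exact ENNReal.coe_le_coe.2 hreal
  refine (ENNReal.mul_le_mul_iff_right two_ne_zero ENNReal.ofNat_ne_top).1 ?_
  calc 2 * ∑' i, ‖⟪C (onBasis H i), A (onBasis H i)⟫_ℂ‖ₑ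
      = ∑' i, 2 * ‖⟪C (onBasis H i), A (onBasis H i)⟫_ℂ‖ₑ := ENNReal.tsum_mul_left.symm
    _ ≤ hsNormSq (R ∘L C) + hsNormSq R := by
        rw [hsNormSq, hsNormSq, ← ENNReal.tsum_add]
        exact ENNReal.tsum_le_tsum fun i => hamgm _
    _ ≤ hsNormSq R + hsNormSq R := by
        gcongr
        exact hsNormSq_comp_le_of_norm_le_one R C hC
    _ = 2 * posTrace A := by rw [posTrace_eq_hsNormSq_sqrt hA, two_mul]

end Trace

section Douglas

variable {H H₁ H₂ H₃ : Type*} [NormedAddCommGroup H] [InnerProductSpace ℂ H]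
  [NormedAddCommGroup H₁] [InnerProductSpace ℂ H₁] [CompleteSpace H₁]
  [NormedAddCommGroup H₂] [InnerProductSpace ℂ H₂] [CompleteSpace H₂]
  [NormedAddCommGroup H₃] [InnerProductSpace ℂ H₃] [CompleteSpace H₃]

theorem exists_norm_le_one_comp_eq {T : H →L[ℂ] H₁} {A : H →L[ℂ] H₂} (h : ∀ x, ‖A x‖ ≤ ‖T x‖) :
    ∃ C : H₁ →L[ℂ] H₂, ‖C‖ ≤ 1 ∧ C ∘L T = A ∧ ∀ x ∈ T.rangeᗮ, C x = 0 := by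
  let M := T.range.topologicalClosure
  have hM : ∀ x, T x ∈ M := fun x => T.range.le_topologicalClosure ⟨x, rfl⟩
  let e : H →ₗ[ℂ] M := T.toLinearMap.codRestrict M hM
  have hdense : DenseRange e := by
    rw [DenseRange, Subtype.dense_iff]
    refine fun x hx => closure_mono ?_ hx
    rintro _ ⟨y, rfl⟩
    exact ⟨e y, ⟨y, rfl⟩, rfl⟩
  have hnorm : ∀ x, ‖A.toLinearMap x‖ ≤ 1 * ‖e x‖ := fun x => (h x).trans_eq (one_mul _).symm
  refine ⟨A.toLinearMap.extendOfNorm e ∘L M.orthogonalProjectionOnto, ?_, ?_, fun x hx => ?_⟩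
  · exact (ContinuousLinearMap.opNorm_comp_le _ _).trans (mul_le_one₀
      (LinearMap.opNorm_extendOfNorm_le hdense zero_le_one hnorm) (norm_nonneg _)
      M.orthogonalProjectionOnto_norm_le)
  · ext x
    have hproj : M.orthogonalProjectionOnto (T x) = e x :=
      M.orthogonalProjectionOnto_mem_subspace_eq_self ⟨T x, hM x⟩
    rw [ContinuousLinearMap.comp_apply, ContinuousLinearMap.comp_apply, hproj]
    exact LinearMap.extendOfNorm_eq hdense ⟨1, hnorm⟩ x
  · rw [ContinuousLinearMap.comp_apply, Submodule.orthogonalProjectionOnto_eq_zero_iff.2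
      (by rwa [Submodule.orthogonal_closure]), map_zero]

theorem norm_sq_eq_add_of_adjoint_comp_eq [CompleteSpace H] {T : H →L[ℂ] H₁} {A : H →L[ℂ] H₂}
    {B : H →L[ℂ] H₃} (h : T.adjoint ∘L T = A.adjoint ∘L A + B.adjoint ∘L B) (x : H) :
    ‖T x‖ ^ 2 = ‖A x‖ ^ 2 + ‖B x‖ ^ 2 := by
  simp only [ContinuousLinearMap.apply_norm_sq_eq_inner_adjoint_right, h, add_apply,
    inner_add_right, map_add]

theorem exists_eq_adjoint_comp_add_adjoint_comp [CompleteSpace H] {T : H →L[ℂ] H₁}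
    {A : H →L[ℂ] H₂} {B : H →L[ℂ] H₃} (h : T.adjoint ∘L T = A.adjoint ∘L A + B.adjoint ∘L B) :
    ∃ (C : H₁ →L[ℂ] H₂) (D : H₁ →L[ℂ] H₃), ‖C‖ ≤ 1 ∧ ‖D‖ ≤ 1 ∧
      T = C.adjoint ∘L A + D.adjoint ∘L B := by
  have hnorm := norm_sq_eq_add_of_adjoint_comp_eq h
  obtain ⟨C, hC, hCT, hC0⟩ := exists_norm_le_one_comp_eq (T := T) (A := A) fun x =>
    (sq_le_sq₀ (norm_nonneg _) (norm_nonneg _)).1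
      ((le_add_of_nonneg_right (sq_nonneg _)).trans_eq (hnorm x).symm)
  obtain ⟨D, hD, hDT, hD0⟩ := exists_norm_le_one_comp_eq (T := T) (A := B) fun x =>
    (sq_le_sq₀ (norm_nonneg _) (norm_nonneg _)).1
      ((le_add_of_nonneg_left (sq_nonneg _)).trans_eq (hnorm x).symm)
  refine ⟨C, D, hC, hD, ContinuousLinearMap.ext fun x => sub_eq_zero.1 ?_⟩
  let S := C.adjoint ∘L A + D.adjoint ∘L B
  -- `S - T` maps into the orthogonal complement of the range of `T`, on which `C` and `D` vanish.
  have horth : T x - S x ∈ T.rangeᗮ := by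
    have hadj : T.adjoint ∘L S = T.adjoint ∘L T := by
      rw [h, ContinuousLinearMap.comp_add, ← ContinuousLinearMap.comp_assoc,
        ← ContinuousLinearMap.comp_assoc, ← ContinuousLinearMap.adjoint_comp,
        ← ContinuousLinearMap.adjoint_comp, hCT, hDT]
    rw [ContinuousLinearMap.orthogonal_range, LinearMap.mem_ker]
    simpa [sub_eq_zero] using (DFunLike.congr_fun hadj x).symm
  have hT0 : ⟪T x - S x, T x⟫_ℂ = 0 :=
    Submodule.inner_left_of_mem_orthogonal (K := T.range) ⟨x, rfl⟩ horth
  have hS0 : ⟪T x - S x, S x⟫_ℂ = 0 := by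
    change ⟪_, C.adjoint (A x) + D.adjoint (B x)⟫_ℂ = 0
    rw [inner_add_right, ContinuousLinearMap.adjoint_inner_right,
      ContinuousLinearMap.adjoint_inner_right, hC0 _ horth, hD0 _ horth, inner_zero_left,
      inner_zero_left, add_zero]
  rw [← inner_self_eq_zero (𝕜 := ℂ), inner_sub_right, hT0, hS0, sub_zero]

end Douglas

section SqrtSumSq

variable {H : Type*} [NormedAddCommGroup H] [InnerProductSpace ℂ H] [CompleteSpace H]

theorem posTrace_le_add {T A B : H →L[ℂ] H} (hA : 0 ≤ A) (hB : 0 ≤ B)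
    (h : T.adjoint ∘L T = A.adjoint ∘L A + B.adjoint ∘L B) :
    posTrace T ≤ posTrace A + posTrace B := by
  obtain ⟨C, D, hC, hD, hT⟩ := exists_eq_adjoint_comp_add_adjoint_comp h
  have hle : ∀ x, ENNReal.ofReal (⟪x, T x⟫_ℂ).re ≤ ‖⟪C x, A x⟫_ℂ‖ₑ + ‖⟪D x, B x⟫_ℂ‖ₑ := fun x => by
    refine (ENNReal.ofReal_le_ofReal (Complex.re_le_norm _)).trans ?_
    rw [ofReal_norm, hT, add_apply, inner_add_right, ContinuousLinearMap.comp_apply,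
      ContinuousLinearMap.comp_apply, ContinuousLinearMap.adjoint_inner_right,
      ContinuousLinearMap.adjoint_inner_right]
    exact enorm_add_le _ _
  calc posTrace T ≤ _ := ENNReal.tsum_le_tsum fun i => hle _
    _ = _ := ENNReal.tsum_add
    _ ≤ _ := add_le_add (tsum_enorm_inner_le_posTrace hA hC) (tsum_enorm_inner_le_posTrace hB hD)

variable {T₁ T₂ : H →L[ℂ] H}

theorem sqrtSumSq_nonneg : 0 ≤ sqrtSumSq T₁ T₂ := CFC.sqrt_nonneg _

theorem abs_sqrtSumSq : CFC.abs (sqrtSumSq T₁ T₂) = sqrtSumSq T₁ T₂ :=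
  CFC.abs_of_nonneg _ sqrtSumSq_nonneg

theorem star_sqrtSumSq_mul_self :
    star (sqrtSumSq T₁ T₂) * sqrtSumSq T₁ T₂ = star T₁ * T₁ + star T₂ * T₂ := by
  have hsa : IsSelfAdjoint (sqrtSumSq T₁ T₂) := sqrtSumSq_nonneg.isSelfAdjoint
  rw [hsa.star_eq, sqrtSumSq, CFC.abs_sq, CFC.abs_sq, CFC.sqrt_mul_sqrt_self _
    (add_nonneg (star_mul_self_nonneg _) (star_mul_self_nonneg _))]

theorem norm_sqrtSumSq_apply_sq (x : H) : ‖sqrtSumSq T₁ T₂ x‖ ^ 2 = ‖T₁ x‖ ^ 2 + ‖T₂ x‖ ^ 2 :=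
  norm_sq_eq_add_of_adjoint_comp_eq star_sqrtSumSq_mul_self x

theorem star_abs_mul_abs (T : H →L[ℂ] H) : star (CFC.abs T) * CFC.abs T = star T * T := by
  rw [(CFC.abs_nonneg T).isSelfAdjoint.star_eq, CFC.abs_mul_abs]

theorem posTrace_sqrtSumSq_le :
    posTrace (sqrtSumSq T₁ T₂) ≤ posTrace (CFC.abs T₁) + posTrace (CFC.abs T₂) := by
  refine posTrace_le_add (CFC.abs_nonneg T₁) (CFC.abs_nonneg T₂) ?_
  change star (sqrtSumSq T₁ T₂) * _ = star (CFC.abs T₁) * _ + star (CFC.abs T₂) * _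
  rw [star_sqrtSumSq_mul_self, star_abs_mul_abs, star_abs_mul_abs]

theorem isTraceClass_sqrtSumSq (h₁ : IsTraceClass T₁) (h₂ : IsTraceClass T₂) :
    IsTraceClass (sqrtSumSq T₁ T₂) := by
  rw [isTraceClass_iff_posTrace_ne_top] at h₁ h₂ ⊢
  rw [abs_sqrtSumSq]
  exact ne_top_of_le_ne_top (ENNReal.add_ne_top.2 ⟨h₁, h₂⟩) posTrace_sqrtSumSq_le

theorem traceNorm_sqrtSumSq_le (h₁ : IsTraceClass T₁) (h₂ : IsTraceClass T₂) :
    traceNorm (sqrtSumSq T₁ T₂) ≤ traceNorm T₁ + traceNorm T₂ := by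
  rw [isTraceClass_iff_posTrace_ne_top] at h₁ h₂
  rw [traceNorm_eq_toReal_posTrace, traceNorm_eq_toReal_posTrace, traceNorm_eq_toReal_posTrace,
    abs_sqrtSumSq, ← ENNReal.toReal_add h₁ h₂]
  exact ENNReal.toReal_mono (ENNReal.add_ne_top.2 ⟨h₁, h₂⟩) posTrace_sqrtSumSq_le

end SqrtSumSq

section Eigenbasis

variable {H : Type u} [NormedAddCommGroup H] [InnerProductSpace ℂ H]

theorem detOneAdd_eq_tprod {S : H →L[ℂ] H} {κ : ℝ → Type*}
    (hκ : ∀ s ≠ 0, Finite (κ s) ∧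
      Nat.card (κ s) = Module.finrank ℂ (Module.End.eigenspace (S : H →ₗ[ℂ] H) (s : ℂ)))
    (hsum : Summable fun j : Σ s, κ s => j.1) : detOneAdd S = ∏' j : Σ s, κ s, (1 + j.1) := by
  have hfib : ∀ s : ℝ, HasProd (fun _ : κ s => 1 + s)
      ((1 + s) ^ Module.finrank ℂ (Module.End.eigenspace (S : H →ₗ[ℂ] H) (s : ℂ))) := fun s => by
    rcases eq_or_ne s 0 with rfl | hs
    · simpa only [add_zero, one_pow] using hasProd_one
    · obtain ⟨_, hcard⟩ := hκ s hs
      have := Fintype.ofFinite (κ s)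
      simpa [← hcard] using hasProd_fintype fun _ : κ s => 1 + s
  rw [(Real.multipliable_one_add_of_summable hsum).tprod_sigma' fun s => (hfib s).multipliable]
  exact tprod_congr fun s => (hfib s).tprod_eq.symm

variable [CompleteSpace H]

theorem exists_hilbertBasis_sigma {I : Type*} {V : I → Submodule ℂ H} [∀ i, CompleteSpace (V i)]
    (hV : OrthogonalFamily ℂ (fun i => V i) fun i => (V i).subtypeₗᵢ) (htotal : (⨆ i, V i)ᗮ = ⊥)
    {κ : I → Type*} (e : ∀ i, HilbertBasis (κ i) ℂ (V i)) :
    ∃ b : HilbertBasis (Σ i, κ i) ℂ H, ∀ a, b a = e a.1 a.2 := by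
  have hon := hV.orthonormal_sigma_orthonormal fun i => (e i).orthonormal
  refine ⟨HilbertBasis.mkOfOrthogonalEqBot hon (eq_bot_iff.2 fun x hx => ?_), fun a => by simp⟩
  rw [← htotal, ← Submodule.iInf_orthogonal, Submodule.mem_iInf]
  refine fun i => Submodule.orthogonalProjectionOnto_eq_zero_iff.1
    ((e i).repr.injective (lp.ext (funext fun k => ?_)))
  rw [(e i).repr_apply_apply, Submodule.inner_orthogonalProjectionOnto_eq_of_mem_left, map_zero]
  exact (Submodule.mem_orthogonal _ _).1 hx _ (Submodule.subset_span ⟨⟨i, k⟩, rfl⟩)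

theorem orthogonalComplement_iSup_real_eigenspaces_eq_bot {S : H →L[ℂ] H}
    (hS : (S : H →ₗ[ℂ] H).IsSymmetric) (hc : IsCompactOperator S) :
    (⨆ s : ℝ, Module.End.eigenspace (S : H →ₗ[ℂ] H) (s : ℂ))ᗮ = ⊥ := by
  rw [eq_bot_iff, ← ContinuousLinearMap.orthogonalComplement_iSup_eigenspaces_eq_bot hc hS]
  refine Submodule.orthogonal_le (iSup_le fun μ => ?_)
  by_cases hμ : Module.End.HasEigenvalue (S : H →ₗ[ℂ] H) μ
  · rw [← Complex.conj_eq_iff_re.1 (hS.conj_eigenvalue_eq_self hμ)]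
    exact le_iSup (fun s : ℝ => Module.End.eigenspace (S : H →ₗ[ℂ] H) (s : ℂ)) μ.re
  · rw [Module.End.hasEigenvalue_iff, not_not] at hμ
    exact hμ ▸ bot_le

theorem exists_eigenbasis {S : H →L[ℂ] H} (hS : (S : H →ₗ[ℂ] H).IsSymmetric)
    (hc : IsCompactOperator S) :
    ∃ (κ : ℝ → Type u) (b : HilbertBasis (Σ s, κ s) ℂ H), (∀ j, S (b j) = (j.1 : ℂ) • b j) ∧
      ∀ s ≠ 0, Finite (κ s) ∧
        Nat.card (κ s) = Module.finrank ℂ (Module.End.eigenspace (S : H →ₗ[ℂ] H) (s : ℂ)) := by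
  let V := fun s : ℝ => Module.End.eigenspace (S : H →ₗ[ℂ] H) (s : ℂ)
  have (s : ℝ) : CompleteSpace (V s) :=
    (ContinuousLinearMap.isClosed_eigenspace S (s : ℂ)).completeSpace_coe
  obtain ⟨b, hb⟩ := exists_hilbertBasis_sigma (V := V)
    (hS.orthogonalFamily_eigenspaces.comp Complex.ofReal_injective)
    (orthogonalComplement_iSup_real_eigenspaces_eq_bot hS hc) fun s => onBasis (V s)
  refine ⟨_, b, fun j => ?_, fun s hs => ?_⟩
  · rw [hb]
    exact Module.End.mem_eigenspace_iff.1 (onBasis (V j.1) j.2).2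
  · have : FiniteDimensional ℂ (V s) :=
      ContinuousLinearMap.finite_dimensional_eigenspace hc (s : ℂ) (by exact_mod_cast hs)
    have hfin := (onBasis (V s)).orthonormal.linearIndependent.finite
    have := Fintype.ofFinite (exists_hilbertBasis ℂ (V s)).choose
    exact ⟨hfin, (Module.finrank_eq_nat_card_basis
      (onBasis (V s)).toOrthonormalBasis.toBasis).symm⟩

theorem exists_eigenbasis_detOneAdd_eq_tprod {S : H →L[ℂ] H} (hS : 0 ≤ S) (htr : IsTraceClass S) :
    ∃ (J : Type u) (b : HilbertBasis J ℂ H) (σ : J → ℝ), (∀ j, 0 ≤ σ j) ∧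
      (∀ j, S (b j) = (σ j : ℂ) • b j) ∧ HasSum σ (traceNorm S) ∧
      detOneAdd S = ∏' j, (1 + σ j) := by
  rw [isTraceClass_iff_posTrace_ne_top, CFC.abs_of_nonneg S hS] at htr
  obtain ⟨κ, b, hb, hκ⟩ :=
    exists_eigenbasis hS.isSelfAdjoint.isSymmetric (isCompactOperator_of_posTrace_ne_top hS htr)
  have hdiag : ∀ j, (⟪b j, S (b j)⟫_ℂ).re = j.1 := fun j => by
    rw [hb, inner_smul_right, inner_self_eq_norm_sq_to_K, b.orthonormal.1]
    simp
  have hpos : ∀ j : Σ s, κ s, 0 ≤ j.1 := fun j => hdiag j ▸ re_inner_apply_self_nonneg hS _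
  have hsum : HasSum (fun j : Σ s, κ s => j.1) (traceNorm S) := by
    rw [traceNorm_eq_toReal_posTrace, CFC.abs_of_nonneg S hS]
    rw [posTrace_eq_tsum b hS] at htr ⊢
    rw [ENNReal.tsum_toReal_eq fun _ => ENNReal.ofReal_ne_top]
    simpa only [hdiag, ENNReal.toReal_ofReal (hpos _)] using ENNReal.hasSum_toReal htr
  exact ⟨_, b, fun j => j.1, hpos, hb, hsum, detOneAdd_eq_tprod hκ hsum.summable⟩

end Eigenbasis

theorem tprod_one_add_le_exp_tsum {J : Type*} {σ : J → ℝ} (hσ : ∀ j, 0 ≤ σ j) (hs : Summable σ) :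
    ∏' j, (1 + σ j) ≤ Real.exp (∑' j, σ j) :=
  (Real.multipliable_one_add_of_summable hs).tprod_le_of_prod_le fun s =>
    (Real.prod_one_add_le_exp_sum s hσ).trans (Real.exp_le_exp.2 (hs.sum_le_tsum s fun j _ => hσ j))

section FockBasis

variable {K : Type u} [NormedAddCommGroup K] [InnerProductSpace ℂ K]

theorem wedge_cons_cons_self (ψ : K) (l : List K) : wedge (ψ :: ψ :: l) = 0 := by
  simp [wedge, ← mul_assoc]

theorem wedge_cons_cons_swap (ψ χ : K) (l : List K) :
    wedge (ψ :: χ :: l) = -wedge (χ :: ψ :: l) := by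
  simp only [wedge_cons]
  exact eq_neg_of_add_eq_zero_left (DFunLike.congr_fun (creation_mul_creation_add ψ χ) (wedge l))

theorem wedge_eq_or_eq_neg_of_perm {l l' : List K} (h : l.Perm l') :
    wedge l = wedge l' ∨ wedge l = -wedge l' := by
  induction h with
  | nil => exact Or.inl rfl
  | cons ψ _ ih =>
    exact ih.imp (by simp +contextual [wedge_cons]) (by simp +contextual [wedge_cons])
  | swap ψ χ l => exact Or.inr (wedge_cons_cons_swap χ ψ l)
  | trans _ _ ih ih' => rcases ih with ih | ih <;> rcases ih' with ih' | ih' <;> simp [ih, ih']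

theorem inner_wedge_cons_left (ψ : K) (l : List K) (x : Fock K) :
    ⟪wedge (ψ :: l), x⟫_ℂ = ⟪wedge l, annihilation ψ x⟫_ℂ := by
  rw [wedge_cons, annihilation, ContinuousLinearMap.adjoint_inner_right]

theorem annihilation_wedge_cons (ψ χ : K) (l : List K) :
    annihilation ψ (wedge (χ :: l)) =
      ⟪ψ, χ⟫_ℂ • wedge l - creation χ (annihilation ψ (wedge l)) := by
  rw [wedge_cons]
  exact eq_sub_of_add_eq (DFunLike.congr_fun (annihilation_mul_creation_add ψ χ) (wedge l))

theorem annihilation_wedge_eq_zero {ψ : K} {l : List K} (h : ∀ χ ∈ l, ⟪ψ, χ⟫_ℂ = 0) :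
    annihilation ψ (wedge l) = 0 := by
  induction l with
  | nil => exact annihilation_vacuum ψ
  | cons χ l ih =>
    obtain ⟨hχ, hl⟩ := List.forall_mem_cons.1 h
    rw [annihilation_wedge_cons, hχ, ih hl, zero_smul, map_zero, sub_zero]

variable {J : Type*} {b : J → K}

theorem annihilation_wedge_map_eq_zero (hb : Orthonormal ℂ b) {j : J} {l : List J} (hj : j ∉ l) :
    annihilation (b j) (wedge (l.map b)) = 0 :=
  annihilation_wedge_eq_zero
    (List.forall_mem_map.2 fun _ hk => hb.2 (ne_of_mem_of_not_mem hk hj).symm)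

theorem inner_wedge_map_self (hb : Orthonormal ℂ b) {l : List J} (hl : l.Nodup) :
    ⟪wedge (l.map b), wedge (l.map b)⟫_ℂ = 1 := by
  induction l with
  | nil => simp [wedge_nil, inner_self_eq_norm_sq_to_K, norm_vacuum]
  | cons j l ih =>
    obtain ⟨hj, hl⟩ := List.nodup_cons.1 hl
    rw [List.map_cons, inner_wedge_cons_left, annihilation_wedge_cons,
      annihilation_wedge_map_eq_zero hb hj, map_zero, sub_zero, inner_self_eq_norm_sq_to_K, hb.1,
      RCLike.ofReal_one, one_pow, one_smul, ih hl]

theorem inner_wedge_map_eq_zero (hb : Orthonormal ℂ b) {l l' : List J} {j : J}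
    (hj : j ∈ l) (hj' : j ∉ l') : ⟪wedge (l.map b), wedge (l'.map b)⟫_ℂ = 0 := by
  classical
  have hcons : ⟪wedge ((j :: l.erase j).map b), wedge (l'.map b)⟫_ℂ = 0 := by
    rw [List.map_cons, inner_wedge_cons_left, annihilation_wedge_map_eq_zero hb hj',
      inner_zero_right]
  rcases wedge_eq_or_eq_neg_of_perm ((List.perm_cons_erase hj).map b) with h | h
  · rw [h, hcons]
  · rw [h, inner_neg_left, hcons, neg_zero]

theorem orthonormal_wedge (hb : Orthonormal ℂ b) :
    Orthonormal ℂ fun s : Finset J => wedge (s.toList.map b) := by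
  refine ⟨fun s => ?_, fun s t hst => ?_⟩
  · rw [@norm_eq_sqrt_re_inner ℂ, inner_wedge_map_self hb s.nodup_toList, RCLike.one_re,
      Real.sqrt_one]
  · have inner_eq_zero {s t : Finset J} (h : ¬s ⊆ t) :
        ⟪wedge (s.toList.map b), wedge (t.toList.map b)⟫_ℂ = 0 := by
      obtain ⟨j, hj, hj'⟩ := Finset.not_subset.1 h
      exact inner_wedge_map_eq_zero hb (Finset.mem_toList.2 hj) (by rwa [Finset.mem_toList])
    by_cases h : s ⊆ t
    · exact inner_eq_zero_symm.1 (inner_eq_zero fun h' => hst (h.antisymm h'))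
    · exact inner_eq_zero h

theorem wedge_map_mem_span (b : J → K) (l : List J) :
    wedge (l.map b) ∈ Submodule.span ℂ (Set.range fun s : Finset J => wedge (s.toList.map b)) := by
  classical
  by_cases hl : l.Nodup
  · have hmem := Submodule.subset_span (R := ℂ)
      (Set.mem_range_self (f := fun s : Finset J => wedge (s.toList.map b)) l.toFinset)
    rcases wedge_eq_or_eq_neg_of_perm ((List.toFinset_toList hl).symm.map b) with h | h
    · exact h ▸ hmem
    · exact h ▸ neg_mem hmem
  · obtain ⟨j, hj⟩ := List.exists_duplicate_iff_not_nodup.2 hl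
    obtain ⟨l', hl'⟩ := (List.duplicate_iff_sublist.1 hj).exists_perm_append
    have hzero : wedge (([j, j] ++ l').map b) = 0 := wedge_cons_cons_self (b j) (l'.map b)
    have : wedge (l.map b) = 0 := by
      rcases wedge_eq_or_eq_neg_of_perm (hl'.map b) with h | h <;> simp only [h, hzero, neg_zero]
    exact this ▸ zero_mem _

theorem creation_mem_span_wedge {ψ : K} (hψ : ψ ∈ Submodule.span ℂ (Set.range b)) {x : Fock K}
    (hx : x ∈ Submodule.span ℂ (Set.range fun s : Finset J => wedge (s.toList.map b))) :
    creation ψ x ∈ Submodule.span ℂ (Set.range fun s : Finset J => wedge (s.toList.map b)) := by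
  induction hψ using Submodule.span_induction with
  | mem ψ hψ =>
    obtain ⟨j, rfl⟩ := hψ
    induction hx using Submodule.span_induction with
    | mem x hx =>
      obtain ⟨s, rfl⟩ := hx
      simpa only [List.map_cons, wedge_cons] using wedge_map_mem_span b (j :: s.toList)
    | zero => rw [map_zero]; exact zero_mem _
    | add x y _ _ hx hy => rw [map_add]; exact add_mem hx hy
    | smul c x _ hx => rw [map_smul]; exact Submodule.smul_mem _ c hx
  | zero => rw [← zero_smul ℂ (0 : K), creation_smul, zero_smul]; exact zero_mem _
  | add ψ χ _ _ hψ hχ => rw [creation_add]; exact add_mem hψ hχ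
  | smul c ψ _ hψ => rw [creation_smul]; exact Submodule.smul_mem _ c hψ

theorem toFock_map_subtype_mem_span_wedge
    (w : ExteriorAlgebra ℂ (Submodule.span ℂ (Set.range b))) :
    toFock (ExteriorAlgebra.map (Submodule.span ℂ (Set.range b)).subtype w) ∈
      Submodule.span ℂ (Set.range fun s : Finset J => wedge (s.toList.map b)) := by
  induction w using exteriorAlgebra_left_induction with
  | algebraMap c =>
    rw [AlgHom.commutes, Algebra.algebraMap_eq_smul_one, map_smul]
    exact Submodule.smul_mem _ c (wedge_map_mem_span b [])
  | add w w' hw hw' => rw [map_add, map_add]; exact add_mem hw hw'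
  | ι_mul w ψ hw =>
    rw [map_mul, ExteriorAlgebra.map_apply_ι, ← creation_toFock]
    exact creation_mem_span_wedge ψ.2 hw

theorem exists_hilbertBasis_wedge (b : HilbertBasis J ℂ K) :
    ∃ e : HilbertBasis (Finset J) ℂ (Fock K), ∀ s, e s = wedge (s.toList.map b) := by
  have hspan : Dense (Submodule.span ℂ (Set.range b) : Set K) :=
    Submodule.dense_iff_topologicalClosure_eq_top.2 b.dense_span
  have hdense : Dense (Submodule.span ℂ
      (Set.range fun s : Finset J => wedge (s.toList.map b)) : Set (Fock K)) :=
    (denseRange_toFock_map_subtype hspan).mono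
      (Set.range_subset_iff.2 toFock_map_subtype_mem_span_wedge)
  exact ⟨HilbertBasis.mk (orthonormal_wedge b.orthonormal)
    (Submodule.dense_iff_topologicalClosure_eq_top.1 hdense).ge, fun s => by
      rw [HilbertBasis.coe_mk]⟩

end FockBasis

section Nuclear

theorem hasSum_comp_extend {ι κ α G : Type*} [Zero α] [AddCommMonoid G] [TopologicalSpace G]
    {S : Set ι} {f : S → κ} (hf : f.Injective) {p : ι → α} {g : α → G} (hg : g 0 = 0)
    (hS : (Function.support fun i => g (p i)) ⊆ S) {a : G} (ha : HasSum (fun i => g (p i)) a) :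
    HasSum (fun k => g (Function.extend f (fun i => p i) 0 k)) a := by
  have hext : (fun k => g (Function.extend f (fun i => p i) 0 k))
      = Function.extend f (fun i => g (p i)) 0 := by
    funext k
    rw [Function.apply_extend g]
    exact congrArg (fun z => Function.extend f _ z k) (funext fun _ => hg)
  rw [hext, hasSum_extend_zero hf]
  exact (hasSum_subtype_iff_of_support_subset hS).2 ha

variable {E F : Type*} [NormedAddCommGroup E] [NormedSpace ℂ E] [NormedAddCommGroup F]
  [NormedSpace ℂ F]

theorem nuclearNorm_le {Ξ : E →ₗ[ℂ] F} {ρ : ℕ → StrongDual ℂ E} {Ψ : ℕ → F}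
    (h : IsNuclearRep Ξ ρ Ψ) : nuclearNorm Ξ ≤ ∑' k, ‖ρ k‖ * ‖Ψ k‖ := by
  refine csInf_le ⟨0, ?_⟩ ⟨ρ, Ψ, h, rfl⟩
  rintro _ ⟨ρ, Ψ, -, rfl⟩
  exact tsum_nonneg fun _ => by positivity

theorem exists_isNuclearRep {ι : Type*} {Ξ : E →ₗ[ℂ] F} {ρ : ι → StrongDual ℂ E} {Ψ : ι → F}
    (h : ∀ A, HasSum (fun i => ρ i A • Ψ i) (Ξ A)) (hs : Summable fun i => ‖ρ i‖ * ‖Ψ i‖) :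
    ∃ ρ' Ψ', IsNuclearRep Ξ ρ' Ψ' ∧ ∑' k, ‖ρ' k‖ * ‖Ψ' k‖ = ∑' i, ‖ρ i‖ * ‖Ψ i‖ := by
  -- Only countably many terms are nonzero; list those and pad with zeros.
  let S := Function.support fun i => ‖ρ i‖ * ‖Ψ i‖
  have : Countable S := hs.countable_support
  obtain ⟨f, hf⟩ := exists_injective_nat S
  let p : ℕ → StrongDual ℂ E × F := Function.extend f (fun i => (ρ i, Ψ i)) 0
  have hsum : HasSum (fun k => ‖(p k).1‖ * ‖(p k).2‖) (∑' i, ‖ρ i‖ * ‖Ψ i‖) :=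
    hasSum_comp_extend hf (p := fun i => (ρ i, Ψ i)) (g := fun q => ‖q.1‖ * ‖q.2‖) (by simp)
      subset_rfl hs.hasSum
  have hterm {A : E} {i : ι} (hi : ρ i A • Ψ i ≠ 0) : i ∈ S := by
    contrapose! hi
    rcases mul_eq_zero.1 (Function.notMem_support.1 hi) with hρ | hΨ
    · rw [norm_eq_zero.1 hρ, zero_apply, zero_smul]
    · rw [norm_eq_zero.1 hΨ, smul_zero]
  refine ⟨fun k => (p k).1, fun k => (p k).2, ⟨fun A => ?_, hsum.summable⟩, hsum.tsum_eq⟩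
  exact hasSum_comp_extend hf (p := fun i => (ρ i, Ψ i)) (g := fun q => q.1 A • q.2) (by simp)
    (fun i hi => hterm hi) (h A)

theorem isNuclear_and_nuclearNorm_le {H : Type*} [NormedAddCommGroup H] [InnerProductSpace ℂ H]
    {ι : Type*} (e : HilbertBasis ι ℂ H) {Ξ : E →ₗ[ℂ] H} {c : ι → ℝ} (hc0 : ∀ i, 0 ≤ c i)
    (hc : Summable c) (h : ∀ i A, ‖⟪e i, Ξ A⟫_ℂ‖ ≤ c i * ‖A‖) :
    IsNuclear Ξ ∧ nuclearNorm Ξ ≤ ∑' i, c i := by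
  let ρ : ι → StrongDual ℂ E := fun i =>
    LinearMap.mkContinuous (innerₛₗ ℂ (e i) ∘ₗ Ξ) (c i) (h i)
  have hρ : ∀ i, ‖ρ i‖ * ‖e i‖ ≤ c i := fun i => by
    rw [e.orthonormal.1, mul_one]
    exact LinearMap.mkContinuous_norm_le _ (hc0 i) _
  have hs : Summable fun i => ‖ρ i‖ * ‖e i‖ := hc.of_nonneg_of_le (fun _ => by positivity) hρ
  have hrep : ∀ A, HasSum (fun i => ρ i A • e i) (Ξ A) := fun A => by
    have hrepr := e.hasSum_repr (Ξ A)
    simp only [HilbertBasis.repr_apply_apply] at hrepr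
    exact hrepr
  obtain ⟨ρ', Ψ', hrep', hsum⟩ := exists_isNuclearRep hrep hs
  exact ⟨⟨ρ', Ψ', hrep'⟩, (nuclearNorm_le hrep').trans (hsum.trans_le (hs.tsum_le_tsum hρ hc))⟩

end Nuclear

section TraceSmul

variable {H : Type u} [NormedAddCommGroup H] [InnerProductSpace ℂ H] [CompleteSpace H]

theorem re_inner_abs_smul_apply_self (c : ℂ) (T : H →L[ℂ] H) (x : H) :
    (⟪x, CFC.abs (c • T) x⟫_ℂ).re = ‖c‖ * (⟪x, CFC.abs T x⟫_ℂ).re := by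
  rw [CFC.abs_smul, smul_apply, inner_smul_right_eq_smul, Complex.smul_re, smul_eq_mul]

theorem IsTraceClass.smul {T : H →L[ℂ] H} (hT : IsTraceClass T) (c : ℂ) : IsTraceClass (c • T) := by
  simpa only [IsTraceClass, re_inner_abs_smul_apply_self] using Summable.mul_left ‖c‖ hT

theorem traceNorm_smul (c : ℂ) (T : H →L[ℂ] H) : traceNorm (c • T) = ‖c‖ * traceNorm T := by
  simp only [traceNorm, re_inner_abs_smul_apply_self, tsum_mul_left]

theorem detOneAdd_le_exp_traceNorm {S : H →L[ℂ] H} (hS : 0 ≤ S) (htr : IsTraceClass S) :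
    detOneAdd S ≤ Real.exp (traceNorm S) := by
  obtain ⟨J, b, σ, hσ, -, hsum, hdet⟩ := exists_eigenbasis_detOneAdd_eq_tprod hS htr
  rw [hdet, ← hsum.tsum_eq]
  exact tprod_one_add_le_exp_tsum hσ hsum.summable

end TraceSmul

section NuclearityBound

variable {K : Type u} [NormedAddCommGroup K] [InnerProductSpace ℂ K]

theorem isNuclear_and_nuclearNorm_le_tprod {E : Type*} [NormedAddCommGroup E] [NormedSpace ℂ E]
    {J : Type*} (b : HilbertBasis J ℂ K) {Ξ : E →ₗ[ℂ] Fock K} {σ : J → ℝ} (hσ : ∀ j, 0 ≤ σ j)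
    (hs : Summable σ) (h : ∀ (l : List J) A, ‖⟪wedge (l.map b), Ξ A⟫_ℂ‖ ≤ (l.map σ).prod * ‖A‖) :
    IsNuclear Ξ ∧ nuclearNorm Ξ ≤ ∏' j, (1 + σ j) := by
  obtain ⟨e, he⟩ := exists_hilbertBasis_wedge b
  have hprod := summable_finsetProd_of_summable_nonneg hσ hs
  rw [tprod_one_add hprod]
  refine isNuclear_and_nuclearNorm_le e (fun s => Finset.prod_nonneg fun j _ => hσ j) hprod
    fun s A => ?_
  rw [he, ← Finset.prod_map_toList]
  exact h s.toList A

variable [CompleteSpace K]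

theorem sumDiffNorm_le_norm_two_smul_sqrtSumSq (T₁ T₂ : K →L[ℂ] K) (x : K) :
    sumDiffNorm (T₁ x) (T₂ x) ≤ ‖((2 : ℂ) • sqrtSumSq T₁ T₂) x‖ := by
  have hsq := norm_sqrtSumSq_apply_sq (T₁ := T₁) (T₂ := T₂) x
  have hpar := parallelogram_law_with_norm ℂ (T₁ x) (T₂ x)
  rw [smul_apply, norm_smul, Complex.norm_two, sumDiffNorm,
    ← sq_le_sq₀ (by positivity) (by positivity)]
  nlinarith [sq_nonneg (‖T₁ x - T₂ x‖ - ‖T₁ x + T₂ x‖)]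

theorem isNuclear_and_nuclearNorm_le_detOneAdd {E : Type*} [NormedAddCommGroup E]
    [NormedSpace ℂ E] {Ξ : E →ₗ[ℂ] Fock K} {c : K → ℝ} (hc : ∀ ξ, 0 ≤ c ξ) {S : K →L[ℂ] K}
    (hS : 0 ≤ S) (htr : IsTraceClass S) (hcS : ∀ ξ, c ξ ≤ ‖S ξ‖)
    (h : ∀ (l : List K) A, ‖⟪wedge l, Ξ A⟫_ℂ‖ ≤ (l.map c).prod * ‖A‖) :
    IsNuclear Ξ ∧ nuclearNorm Ξ ≤ detOneAdd S := by
  obtain ⟨J, b, σ, hσ, hb, hsum, hdet⟩ := exists_eigenbasis_detOneAdd_eq_tprod hS htr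
  have hcσ : ∀ j, c (b j) ≤ σ j := fun j => by
    have hj := hcS (b j)
    rwa [hb, norm_smul, b.orthonormal.1, mul_one, Complex.norm_of_nonneg (hσ j)] at hj
  rw [hdet]
  refine isNuclear_and_nuclearNorm_le_tprod b hσ hsum.summable fun l A => (h _ A).trans ?_
  rw [List.map_map]
  gcongr
  exact List.prod_map_le_prod_map₀ _ _ (fun j _ => hc (b j)) fun j _ => hcσ j

end NuclearityBound

end FermiFock

end

theorem proposition2p2_general {K : Type*} [NormedAddCommGroup K] [InnerProductSpace ℂ K]
    [CompleteSpace K] {Γ : K →ₗ⋆[ℂ] K} (hΓ : FermiFock.IsAntilinearInvolution Γ)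
    {Lφ Lπ : Submodule ℂ K} [Lφ.HasOrthogonalProjection] [Lπ.HasOrthogonalProjection]
    (hLφ : ∀ ψ ∈ Lφ, Γ ψ ∈ Lφ) (hLπ : ∀ ψ ∈ Lπ, Γ ψ ∈ Lπ)
    {X Y : K →ₗ.[ℂ] K} (hYX : Y.IsFormalAdjoint X) (hY : Dense (Y.domain : Set K))
    (hdom : ∀ A ∈ FermiFock.fieldAlgebra (FermiFock.realSubspace Γ Lφ Lπ),
      A (FermiFock.vacuum K) ∈ (FermiFock.secondQuantization X).domain)
    {Tφ Tπ : K →L[ℂ] K}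
    (hTφ : ∀ ψ : Y.domain, Tφ ψ = Lφ.starProjection (Y ψ))
    (hTπ : ∀ ψ : Y.domain, Tπ ψ = Lπ.starProjection (Y ψ))
    (hTφ_tc : FermiFock.IsTraceClass Tφ) (hTπ_tc : FermiFock.IsTraceClass Tπ) :
    FermiFock.IsNuclear (FermiFock.nuclearityMap X _ hdom) ∧
    FermiFock.IsTraceClass (FermiFock.sqrtSumSq Tφ Tπ) ∧
    FermiFock.nuclearNorm (FermiFock.nuclearityMap X _ hdom)
      ≤ FermiFock.detOneAdd ((2 : ℂ) • FermiFock.sqrtSumSq Tφ Tπ) ∧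
    FermiFock.detOneAdd ((2 : ℂ) • FermiFock.sqrtSumSq Tφ Tπ)
      ≤ Real.exp (2 * FermiFock.traceNorm Tφ) * Real.exp (2 * FermiFock.traceNorm Tπ) := by
  have htc := FermiFock.isTraceClass_sqrtSumSq hTφ_tc hTπ_tc
  have hpos : 0 ≤ (2 : ℂ) • FermiFock.sqrtSumSq Tφ Tπ :=
    two_smul ℂ (FermiFock.sqrtSumSq Tφ Tπ) ▸
      add_nonneg FermiFock.sqrtSumSq_nonneg FermiFock.sqrtSumSq_nonneg
  obtain ⟨hnuc, hnorm⟩ := FermiFock.isNuclear_and_nuclearNorm_le_detOneAdd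
    (fun _ => FermiFock.sumDiffNorm_nonneg _ _) hpos (htc.smul 2)
    (FermiFock.sumDiffNorm_le_norm_two_smul_sqrtSumSq Tφ Tπ) fun l A =>
      FermiFock.norm_inner_wedge_nuclearityMap_le hΓ hLφ hLπ hYX hY hdom hTφ hTπ A l
  refine ⟨hnuc, htc, hnorm, (FermiFock.detOneAdd_le_exp_traceNorm hpos (htc.smul 2)).trans ?_⟩
  rw [← Real.exp_add, Real.exp_le_exp, FermiFock.traceNorm_smul, Complex.norm_two, ← mul_add]
  gcongr
  exact FermiFock.traceNorm_sqrtSumSq_le hTφ_tc hTπ_tc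

theorem proposition2p2 {K : Type*} [NormedAddCommGroup K] [InnerProductSpace ℂ K] [CompleteSpace K]
    (Γ : K →ₗ⋆[ℂ] K) (hΓ : FermiFock.IsAntilinearInvolution Γ)
    (Lφ Lπ : ClosedSubmodule ℂ K)
    (hLφ : ∀ ψ ∈ Lφ, Γ ψ ∈ Lφ) (hLπ : ∀ ψ ∈ Lπ, Γ ψ ∈ Lπ)
    (X : K →ₗ.[ℂ] K) (hX : FermiFock.IsStrictlyPositiveOp X)
    (hXΓ : FermiFock.CommutesWith X Γ)
    (hdom : ∀ A ∈ FermiFock.fieldAlgebra (FermiFock.realSubspace Γ Lφ.toSubmodule Lπ.toSubmodule),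
      A (FermiFock.vacuum K) ∈ (FermiFock.secondQuantization X).domain)
    (Tφ Tπ : K →L[ℂ] K)
    (hTφ : ∀ ψ : X.domain, Tφ ψ = Lφ.toSubmodule.starProjection (X ψ))
    (hTπ : ∀ ψ : X.domain, Tπ ψ = Lπ.toSubmodule.starProjection (X ψ))
    (hTφ_tc : FermiFock.IsTraceClass Tφ) (hTπ_tc : FermiFock.IsTraceClass Tπ) :
    FermiFock.IsNuclear (FermiFock.nuclearityMap X _ hdom) ∧
    FermiFock.IsTraceClass (FermiFock.sqrtSumSq Tφ Tπ) ∧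
    FermiFock.nuclearNorm (FermiFock.nuclearityMap X _ hdom)
      ≤ FermiFock.detOneAdd ((2 : ℂ) • FermiFock.sqrtSumSq Tφ Tπ) ∧
    FermiFock.detOneAdd ((2 : ℂ) • FermiFock.sqrtSumSq Tφ Tπ)
      ≤ Real.exp (2 * FermiFock.traceNorm Tφ) * Real.exp (2 * FermiFock.traceNorm Tπ) :=
  proposition2p2_general hΓ hLφ hLπ hX.symm hX.1 hdom hTφ hTπ hTφ_tc hTπ_tc
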